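/- **Setting.** Let $\mathcal L_{\mathrm{Tr}}$ be the first-order language of arithmetic $(0,\mathsf S,+,\times,=)$ extended by a unary predicate $\mathrm{Tr}$, with logical symbols $\neg,\vee,\wedge,\forall,\exists$; $\varphi\to\psi$ abbreviates $\neg\varphi\vee\psi$, and $\leftrightarrow$ is defined from $\to$ and $\wedge$. Fix a standard Gödel numbering; $\#\varphi$ is the code of $\varphi$, $\ulcorner\varphi\urcorner$ the numeral of $\#\varphi$, $\bar n$ the numeral of $n$. $\mathrm{PAT}$ is Peano arithmetic with the induction schema for all $\mathcal L_{\mathrm{Tr}}$-formulas, and $\mathrm{Pr}(x)$ is a standard arithmetical provability predicate of $\mathrm{PAT}$. $\mathrm{Sent}(x)$ and $\mathrm{CT}(x)$ express that $x$ codes an $\mathcal L_{\mathrm{Tr}}$-sentence, respectively a closed term. The letters $s,t$ range over (codes of) closed terms, $t^\circ$ is the value of $t$, $x(t/v)$ is the result of substituting $t$ for the variable $v$ in $x$, and $\dot x$ is the code of the numeral of $x$. A dot below a symbol denotes the corresponding operation on codes, expressible in the language of arithmetic. $\ulcorner\varphi(\dot x)\urcorner$ is the code of the result of substituting $\dot x$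 for the free variable of $\varphi$. For $S\subseteq\mathbb N$, $(\mathbb N,S)$ is the standard model with $S$ interpreting $\mathrm{Tr}$. $\mathrm{CON}(S)$ says that there is no sentence $\varphi$ with $\{\#\varphi,\#\neg\varphi\}\subseteq S$. **The formulas $\xi$ and $\xi^*$.** $\xi(x,X)$ says that $x$ is the code of a sentence and one of the following holds: 1. $x$ is the code of a true sentence $s=t$ or $\neg\, s=t$ with closed terms $s,t$; 2. $x=\#\neg\neg\varphi$ and $\#\varphi\in X$; 3. $x=\#(\varphi\vee\psi)$ and ($\#\varphi\in X$ or $\#\psi\in X$); 4. $x=\#\neg(\varphi\vee\psi)$ and $\#\neg\varphi,\#\neg\psi\in X$; 5. $x=\#(\varphi\wedge\psi)$ and $\#\varphi,\#\psi\in X$; 6. $x=\#\neg(\varphi\wedge\psi)$ and ($\#\neg\varphi\in X$ or $\#\neg\psi\in X$); 7. $x=\#\forall v\varphi$ and $\#\varphi(t/v)\in X$ for all closed $t$; 8. $x=\#\neg\forall v\varphi$ and $\#\neg\varphi(t/v)\in X$ for some closed $t$; 9. $x=\#\exists v\varphi$ and $\#\varphi(t/v)\in X$ for some closed $t$; 10.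 $x=\#\neg\exists v\varphi$ and $\#\neg\varphi(t/v)\in X$ for all closed $t$; 11. $x=\#\mathrm{Tr}(t)$ for a closed $t$ with $t^\circ\in X$; 12. $x=\#\neg\mathrm{Tr}(t)$ for a closed $t$ such that $\underset{.}{\neg}t^\circ\in X$ or $t^\circ$ is not the code of a sentence. $\xi^*(x,X)$ is the disjunction of $\xi(x,X)$ and the two clauses 13. $x=t^\circ$ is the code of a sentence and $\#\mathrm{Tr}(t)\in X$, for some closed $t$; 14. $x=\underset{.}{\neg}t^\circ$ is the code of a sentence and $\#\neg\mathrm{Tr}(t)\in X$, for some closed $t$. **The operators.** For $S\subseteq\mathbb N$, $$\Theta^*(S)=\{\#\varphi : \text{there is a sentence }\psi\text{ with }\xi^*(\#\psi,S)\text{ and }\mathrm{PAT}\vdash\psi\to\varphi\}.$$ $\Theta^*_{\mathrm c}$ and $\Theta^*_{\mathrm{mc}}$ are defined in the same way, with $\xi^*(\#\psi,S)$ replaced by "$\xi^*(\#\psi,S)$ or $\mathrm{con}(\#\psi)$" and by "$\xi^*(\#\psi,S)$ or $\mathrm{com}(\#\psi)$", respectively. Here $\mathrm{con}(x)$ says that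 $x=\#\neg(\mathrm{Tr}(s)\wedge\mathrm{Tr}(\underset{.}{\neg}t))$ for closed terms $s,t$ with $s^\circ=t^\circ$, and $\mathrm{com}(x)$ says that $x=\#(\neg\mathrm{Tr}(s)\leftrightarrow\mathrm{Tr}(\underset{.}{\neg}t))$ for closed terms $s,t$ with $s^\circ=t^\circ$ the code of a sentence. **The theories.** $\mathrm{IT}^*$ is $\mathrm{PAT}$ together with - IT1: $\forall s,t(\mathrm{Tr}(s\underset{.}{=}t)\leftrightarrow s^\circ=t^\circ)\wedge\forall s,t(\mathrm{Tr}(s\underset{.}{\neq}t)\leftrightarrow s^\circ\neq t^\circ)$ - IT2: $\forall x,y(\mathrm{Sent}(x\underset{.}{\wedge}y)\to(\mathrm{Tr}(x)\wedge\mathrm{Tr}(y)\to\mathrm{Tr}(x\underset{.}{\wedge}y)))$ - IT3: $\forall x,y(\mathrm{Sent}(x\underset{.}{\vee}y)\to(\mathrm{Tr}(x)\vee\mathrm{Tr}(y)\vee\exists z(\xi^*(z,\mathrm{Tr})\wedge\mathrm{Pr}(z\underset{.}{\to}x\underset{.}{\vee}y))\leftrightarrow\mathrm{Tr}(x\underset{.}{\vee}y)))$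 - IT4: $\forall x,v(\mathrm{Sent}(\underset{.}{\forall}vx)\to(\forall t\,\mathrm{Tr}(x(t/v))\to\mathrm{Tr}(\underset{.}{\forall}vx)))$ - IT5: $\forall x,v(\mathrm{Sent}(\underset{.}{\exists}vx)\to(\exists t\,\mathrm{Tr}(x(t/v))\vee\exists w(\xi^*(w,\mathrm{Tr})\wedge\mathrm{Pr}(w\underset{.}{\to}\underset{.}{\exists}vx))\leftrightarrow\mathrm{Tr}(\underset{.}{\exists}vx)))$ - IT6: $\forall x(\mathrm{Tr}(x)\leftrightarrow\mathrm{Tr}(\underset{.}{\mathrm{Tr}}\,\dot x))$ - IT7: $\forall x(\mathrm{Tr}(\underset{.}{\neg}x)\vee\neg\mathrm{Sent}(x)\leftrightarrow\mathrm{Tr}(\underset{.}{\neg}\underset{.}{\mathrm{Tr}}\,\dot x))$ - IT8: $\forall x,y(\mathrm{Tr}(x)\wedge\mathrm{Pr}(x\underset{.}{\to}y)\to\mathrm{Tr}(y))$ - IT9: $\forall x(\mathrm{Tr}(\underset{.}{\neg}x)\to\neg\mathrm{Tr}(x))$ - IT10: $\mathrm{Tr}\ulcorner\forall x(\mathrm{Tr}(x)\to\mathrm{Sent}(x))\urcorner$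 $\mathrm{IT}^*_{\mathrm c}$ is $\mathrm{IT}^*$ plus $\forall x\,\mathrm{Tr}\ulcorner\neg(\mathrm{Tr}\,\dot x\wedge\mathrm{Tr}\,\underset{.}{\neg}\dot x)\urcorner$, and $\mathrm{IT}^*_{\mathrm{mc}}$ is $\mathrm{IT}^*$ plus $\forall x(\mathrm{Sent}(x)\to\mathrm{Tr}\ulcorner\neg\mathrm{Tr}\,\dot x\leftrightarrow\mathrm{Tr}\,\underset{.}{\neg}\dot x\urcorner)$. **Theorem.** $\mathrm{IT}^*$ is $\mathbb N$-categorical with respect to the consistent fixed points of $\Theta^*$; that is, for every $S\subseteq\mathbb N$, $$S=\Theta^*(S)\text{ and }\mathrm{CON}(S)\iff(\mathbb N,S)\models\mathrm{IT}^*.$$ Likewise, for every $S\subseteq\mathbb N$: $S=\Theta^*_{\mathrm c}(S)$ and $\mathrm{CON}(S)$ iff $(\mathbb N,S)\models\mathrm{IT}^*_{\mathrm c}$; and $S=\Theta^*_{\mathrm{mc}}(S)$ and $\mathrm{CON}(S)$ iff $(\mathbb N,S)\models\mathrm{IT}^*_{\mathrm{mc}}$. -/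

import Mathlib

namespace SupTruth

/-! ## The language of arithmetic with a truth predicate

Terms and formulas are well scoped: `Tm n`, `Fm n` have the free variables `0, …, n - 1`, and a
quantifier applied to a formula in `Fm (n + 1)` binds the variable `n` (bound variables are nameless,
so formulas are taken up to renaming of bound variables). The logical symbols are `¬, ∨, ∧, ∀, ∃`. -/

inductive Tm (n : ℕ) : Type
  | var (i : Fin n) : Tm n
  | zero : Tm n
  | succ (t : Tm n) : Tm n
  | add (t u : Tm n) : Tm n
  | mul (t u : Tm n) : Tm n

inductive Fm : ℕ → Type
  | eq {n : ℕ} (t u : Tm n) : Fm n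
  | tr {n : ℕ} (t : Tm n) : Fm n
  | neg {n : ℕ} (φ : Fm n) : Fm n
  | or {n : ℕ} (φ ψ : Fm n) : Fm n
  | and {n : ℕ} (φ ψ : Fm n) : Fm n
  | all {n : ℕ} (φ : Fm (n + 1)) : Fm n
  | ex {n : ℕ} (φ : Fm (n + 1)) : Fm n

/-- Sentences of the language with the truth predicate. -/
abbrev Sentence : Type := Fm 0

/-- Closed terms. -/
abbrev CTm : Type := Tm 0

/-- `φ → ψ` abbreviates `¬φ ∨ ψ`. -/
def Fm.imp {n : ℕ} (φ ψ : Fm n) : Fm n := .or (.neg φ) ψ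

def Fm.iff {n : ℕ} (φ ψ : Fm n) : Fm n := .and (.imp φ ψ) (.imp ψ φ)

infix:60 " ≐ " => Fm.eq
infixr:45 " ⋏ " => Fm.and
infixr:40 " ⋎ " => Fm.or
infixr:35 " ⟹ " => Fm.imp
infix:30 " ⟺ " => Fm.iff

/-! ### Substitution -/

/-- Simultaneous substitution in terms. -/
def Tm.subst {n m : ℕ} (σ : Fin n → Tm m) : Tm n → Tm m
  | .var i => σ i
  | .zero => .zero
  | .succ t => .succ (t.subst σ)
  | .add t u => .add (t.subst σ) (u.subst σ)
  | .mul t u => .mul (t.subst σ) (u.subst σ)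

/-- Regard a term with variables `0, …, n - 1` as a term with variables `0, …, n`. -/
def Tm.lift {n : ℕ} (t : Tm n) : Tm (n + 1) := t.subst fun i => .var i.castSucc

/-- The substitution that acts as `σ` on the old variables and fixes the newly bound one. -/
def liftSubst {n m : ℕ} (σ : Fin n → Tm m) : Fin (n + 1) → Tm (m + 1) :=
  Fin.snoc (fun i => (σ i).lift) (.var (Fin.last m))

/-- Simultaneous (capture-avoiding) substitution in formulas. -/
def Fm.subst : {n m : ℕ} → (Fin n → Tm m) → Fm n → Fm m
  | _, _, σ, .eq t u => .eq (t.subst σ) (u.subst σ)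
  | _, _, σ, .tr t => .tr (t.subst σ)
  | _, _, σ, .neg φ => .neg (φ.subst σ)
  | _, _, σ, .or φ ψ => .or (φ.subst σ) (ψ.subst σ)
  | _, _, σ, .and φ ψ => .and (φ.subst σ) (ψ.subst σ)
  | _, _, σ, .all φ => .all (φ.subst (liftSubst σ))
  | _, _, σ, .ex φ => .ex (φ.subst (liftSubst σ))

/-- `φ` with a dummy free variable `n` added. -/
def Fm.lift {n : ℕ} (φ : Fm n) : Fm (n + 1) := φ.subst fun i => .var i.castSucc

/-- `φ(t)`: substitute `t` for the last free variable. -/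
def Fm.inst {n : ℕ} (φ : Fm (n + 1)) (t : Tm n) : Fm n := φ.subst (Fin.snoc Tm.var t)

/-- `φ(S v)`, where `v` is the last free variable of `φ`. -/
def Fm.instSucc {n : ℕ} (φ : Fm (n + 1)) : Fm (n + 1) :=
  φ.subst (Fin.snoc (fun i : Fin n => Tm.var i.castSucc) (.succ (.var (Fin.last n))))

/-! ### Classical satisfaction in `(ℕ, S)` -/

def Tm.val {n : ℕ} (e : Fin n → ℕ) : Tm n → ℕ
  | .var i => e i
  | .zero => 0
  | .succ t => t.val e + 1
  | .add t u => t.val e + u.val e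
  | .mul t u => t.val e * u.val e

/-- `t°`, the value of a closed term. -/
def ev (t : CTm) : ℕ := t.val ![]

/-- `(ℕ, S) ⊨ φ[e]`: the truth predicate is interpreted by `S`. -/
def Fm.Sat (S : Set ℕ) : {n : ℕ} → Fm n → (Fin n → ℕ) → Prop
  | _, .eq t u, e => t.val e = u.val e
  | _, .tr t, e => t.val e ∈ S
  | _, .neg φ, e => ¬ φ.Sat S e
  | _, .or φ ψ, e => φ.Sat S e ∨ ψ.Sat S e
  | _, .and φ ψ, e => φ.Sat S e ∧ ψ.Sat S e
  | n, .all φ, e => ∀ a : ℕ, φ.Sat S (Fin.snoc e a : Fin (n + 1) → ℕ)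
  | n, .ex φ, e => ∃ a : ℕ, φ.Sat S (Fin.snoc e a : Fin (n + 1) → ℕ)

/-- `(ℕ, S) ⊨ T`. -/
def Models (S : Set ℕ) (T : Set Sentence) : Prop := ∀ φ ∈ T, φ.Sat S ![]

/-! ### Coding -/

/-- An injective pairing function that is given by a term of the language. -/
def pr (a b : ℕ) : ℕ := (a + b) * (a + b) + a

def Tm.code {n : ℕ} : Tm n → ℕ
  | .var i => pr 1 i
  | .zero => pr 2 0
  | .succ t => pr 3 t.code
  | .add t u => pr 4 (pr t.code u.code)
  | .mul t u => pr 5 (pr t.code u.code)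

/-- The code `#φ` of `φ`. -/
def Fm.code : {n : ℕ} → Fm n → ℕ
  | _, .eq t u => pr 6 (pr t.code u.code)
  | _, .tr t => pr 7 t.code
  | _, .neg φ => pr 8 φ.code
  | _, .or φ ψ => pr 9 (pr φ.code ψ.code)
  | _, .and φ ψ => pr 10 (pr φ.code ψ.code)
  | _, .all φ => pr 11 φ.code
  | _, .ex φ => pr 12 φ.code

/-- `x` is the code of a sentence. -/
def IsSent (x : ℕ) : Prop := ∃ φ : Sentence, x = φ.code

/-- The syntactic operation that sends `#φ` to `#¬φ`. -/
def negCode (x : ℕ) : ℕ := pr 8 x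

/-- The numeral of `k`. -/
def nm {n : ℕ} : ℕ → Tm n
  | 0 => .zero
  | k + 1 => .succ (nm k)

/-- The variable `i`. -/
abbrev v {n : ℕ} (i : Fin n) : Tm n := .var i

/-- The syntactic operations (written with a dot under the symbol in informal notation) as terms of the
language. -/
def dPr {n : ℕ} (a b : Tm n) : Tm n := .add (.mul (.add a b) (.add a b)) a
def dVar {n : ℕ} (a : Tm n) : Tm n := dPr (nm 1) a
def dZero {n : ℕ} : Tm n := dPr (nm 2) (nm 0)
def dSucc {n : ℕ} (a : Tm n) : Tm n := dPr (nm 3) a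
def dAdd {n : ℕ} (a b : Tm n) : Tm n := dPr (nm 4) (dPr a b)
def dMul {n : ℕ} (a b : Tm n) : Tm n := dPr (nm 5) (dPr a b)
def dEq {n : ℕ} (a b : Tm n) : Tm n := dPr (nm 6) (dPr a b)
def dTr {n : ℕ} (a : Tm n) : Tm n := dPr (nm 7) a
def dNeg {n : ℕ} (a : Tm n) : Tm n := dPr (nm 8) a
def dOr {n : ℕ} (a b : Tm n) : Tm n := dPr (nm 9) (dPr a b)
def dAnd {n : ℕ} (a b : Tm n) : Tm n := dPr (nm 10) (dPr a b)
def dAll {n : ℕ} (a : Tm n) : Tm n := dPr (nm 11) a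
def dEx {n : ℕ} (a : Tm n) : Tm n := dPr (nm 12) a
def dImp {n : ℕ} (a b : Tm n) : Tm n := dOr (dNeg a) b

/-- `⌜φ⌝`, the numeral of the code of `φ`. -/
def quo {n m : ℕ} (φ : Fm m) : Tm n := nm φ.code

/-! ## The theory PAT

Peano arithmetic formulated in the language with the truth predicate, with induction for all formulas,
over a Hilbert calculus for classical first-order logic with equality. `Prov n φ` says that `φ`, with
free variables among `0, …, n - 1`, is derivable in PAT. -/

/-- Logical axioms. -/
inductive LogAx : (n : ℕ) → Fm n → Prop
  | k {n : ℕ} (a b : Fm n) : LogAx n (a ⟹ b ⟹ a)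
  | s {n : ℕ} (a b c : Fm n) : LogAx n ((a ⟹ b ⟹ c) ⟹ (a ⟹ b) ⟹ a ⟹ c)
  | contra {n : ℕ} (a b : Fm n) : LogAx n ((.neg a ⟹ .neg b) ⟹ b ⟹ a)
  | andLeft {n : ℕ} (a b : Fm n) : LogAx n (a ⋏ b ⟹ a)
  | andRight {n : ℕ} (a b : Fm n) : LogAx n (a ⋏ b ⟹ b)
  | andIntro {n : ℕ} (a b : Fm n) : LogAx n (a ⟹ b ⟹ a ⋏ b)
  | orLeft {n : ℕ} (a b : Fm n) : LogAx n (a ⟹ a ⋎ b)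
  | orRight {n : ℕ} (a b : Fm n) : LogAx n (b ⟹ a ⋎ b)
  | orElim {n : ℕ} (a b c : Fm n) : LogAx n ((a ⟹ c) ⟹ (b ⟹ c) ⟹ a ⋎ b ⟹ c)
  | allElim {n : ℕ} (a : Fm (n + 1)) (t : Tm n) : LogAx n (.all a ⟹ a.inst t)
  | exIntro {n : ℕ} (a : Fm (n + 1)) (t : Tm n) : LogAx n (a.inst t ⟹ .ex a)
  | eqRefl {n : ℕ} (t : Tm n) : LogAx n (t ≐ t)
  | eqSubst {n : ℕ} (a : Fm (n + 1)) (t u : Tm n) : LogAx n (t ≐ u ⟹ a.inst t ⟹ a.inst u)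

/-- The axioms of Peano arithmetic, with induction for all formulas of the language. -/
inductive ArithAx : (n : ℕ) → Fm n → Prop
  | succNeZero {n : ℕ} (t : Tm n) : ArithAx n (.neg (.succ t ≐ .zero))
  | succInj {n : ℕ} (t u : Tm n) : ArithAx n (.succ t ≐ .succ u ⟹ t ≐ u)
  | addZero {n : ℕ} (t : Tm n) : ArithAx n (.add t .zero ≐ t)
  | addSucc {n : ℕ} (t u : Tm n) : ArithAx n (.add t (.succ u) ≐ .succ (.add t u))
  | mulZero {n : ℕ} (t : Tm n) : ArithAx n (.mul t .zero ≐ .zero)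
  | mulSucc {n : ℕ} (t u : Tm n) : ArithAx n (.mul t (.succ u) ≐ .add (.mul t u) t)
  | ind {n : ℕ} (a : Fm (n + 1)) : ArithAx n (a.inst .zero ⋏ .all (a ⟹ a.instSucc) ⟹ .all a)

/-- Derivability in PAT. -/
inductive Prov : (n : ℕ) → Fm n → Prop
  | log {n : ℕ} {a : Fm n} : LogAx n a → Prov n a
  | arith {n : ℕ} {a : Fm n} : ArithAx n a → Prov n a
  | mp {n : ℕ} {a b : Fm n} : Prov n (a ⟹ b) → Prov n a → Prov n b
  | allRule {n : ℕ} {a : Fm n} {b : Fm (n + 1)} : Prov (n + 1) (a.lift ⟹ b) → Prov n (a ⟹ .all b)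
  | exRule {n : ℕ} {a : Fm n} {b : Fm (n + 1)} : Prov (n + 1) (b ⟹ a.lift) → Prov n (.ex b ⟹ a)

/-- PAT as a set of sentences. -/
def PAT : Set Sentence := {φ | Prov 0 φ}

/-! ## The operators -/

/-- `S` does not contain the codes of both a sentence and its negation. -/
def CON (S : Set ℕ) : Prop := ¬ ∃ φ : Sentence, φ.code ∈ S ∧ (Fm.neg φ).code ∈ S

/-- True arithmetic literals. -/
def True0 (χ : Sentence) : Prop :=
  (∃ s t : CTm, χ = (s ≐ t) ∧ ev s = ev t) ∨ (∃ s t : CTm, χ = .neg (s ≐ t) ∧ ev s ≠ ev t)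

/-- The clauses `ξ(x, X)` of Strong Kleene truth, for `x = #χ`. -/
def Xi (X : Set ℕ) (χ : Sentence) : Prop :=
  True0 χ
  ∨ (∃ φ : Sentence, χ = .neg (.neg φ) ∧ φ.code ∈ X)
  ∨ (∃ φ ψ : Sentence, χ = (φ ⋎ ψ) ∧ (φ.code ∈ X ∨ ψ.code ∈ X))
  ∨ (∃ φ ψ : Sentence, χ = .neg (φ ⋎ ψ) ∧ ((Fm.neg φ).code ∈ X ∧ (Fm.neg ψ).code ∈ X))
  ∨ (∃ φ ψ : Sentence, χ = (φ ⋏ ψ) ∧ (φ.code ∈ X ∧ ψ.code ∈ X))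
  ∨ (∃ φ ψ : Sentence, χ = .neg (φ ⋏ ψ) ∧ ((Fm.neg φ).code ∈ X ∨ (Fm.neg ψ).code ∈ X))
  ∨ (∃ φ : Fm 1, χ = .all φ ∧ ∀ t : CTm, (φ.inst t).code ∈ X)
  ∨ (∃ φ : Fm 1, χ = .neg (.all φ) ∧ ∃ t : CTm, (Fm.neg (φ.inst t)).code ∈ X)
  ∨ (∃ φ : Fm 1, χ = .ex φ ∧ ∃ t : CTm, (φ.inst t).code ∈ X)
  ∨ (∃ φ : Fm 1, χ = .neg (.ex φ) ∧ ∀ t : CTm, (Fm.neg (φ.inst t)).code ∈ X)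
  ∨ (∃ t : CTm, χ = .tr t ∧ ev t ∈ X)
  ∨ (∃ t : CTm, χ = .neg (.tr t) ∧ (negCode (ev t) ∈ X ∨ ¬ IsSent (ev t)))

/-- `ξ*(x, X)` for `x = #χ`: the clauses of `ξ` and the two downward clauses for the truth predicate. -/
def XiStar (X : Set ℕ) (χ : Sentence) : Prop :=
  Xi X χ
  ∨ (∃ t : CTm, ev t = χ.code ∧ (Fm.tr t : Sentence).code ∈ X)
  ∨ (∃ (t : CTm) (φ : Sentence), χ = .neg φ ∧ ev t = φ.code ∧
      (Fm.neg (.tr t) : Sentence).code ∈ X)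

/-- `con`: the sentences `¬(Tr s ∧ Tr ¬t)` with `s° = t°` (the inner `¬` is the syntactic operation). -/
def Con (χ : Sentence) : Prop :=
  ∃ s t : CTm, χ = .neg (.tr s ⋏ .tr (dNeg t)) ∧ ev s = ev t

/-- `com`: the sentences `¬Tr s ↔ Tr ¬t` with `s° = t°` the code of a sentence. -/
def Com (χ : Sentence) : Prop :=
  ∃ s t : CTm, χ = (.neg (.tr s) ⟺ .tr (dNeg t)) ∧ ev s = ev t ∧ IsSent (ev t)

/-- `Θ*(S)`. -/
def ThetaStar (S : Set ℕ) : Set ℕ :=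
  {x | ∃ φ ψ : Sentence, x = φ.code ∧ XiStar S ψ ∧ (ψ ⟹ φ) ∈ PAT}

/-- `Θ*_c(S)`. -/
def ThetaStarC (S : Set ℕ) : Set ℕ :=
  {x | ∃ φ ψ : Sentence, x = φ.code ∧ (XiStar S ψ ∨ Con ψ) ∧ (ψ ⟹ φ) ∈ PAT}

/-- `Θ*_mc(S)`. -/
def ThetaStarMC (S : Set ℕ) : Set ℕ :=
  {x | ∃ φ ψ : Sentence, x = φ.code ∧ (XiStar S ψ ∨ Com ψ) ∧ (ψ ⟹ φ) ∈ PAT}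

/-! ## Syntax in the object language

Formulas of the language that represent syntactic notions. `φ.subst ![t, u]` is `φ(t, u)`; the comment
at a formula names its free variables in the order `0, 1, …`, and the variables bound by the successive
quantifiers in it have the next numbers. -/

/-- `x < y`. -/
def ltF : Fm 2 := .ex (.succ (.add (v 0) (v 2)) ≐ v 1)

/-- `y ∈ s`, where the number `s = ⟨a, ⟨b, l⟩⟩` codes the finite set of the `y ≤ l` for which
`1 + (y + 1) * b` divides `a`. -/
def memF : Fm 2 :=
  .ex <| .ex <| .ex <| .ex <| .ex <|
    (v 1 ≐ dPr (v 2) (dPr (v 3) (v 4))) ⋏ (.add (v 0) (v 5) ≐ v 4) ⋏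
      (v 2 ≐ .mul (v 6) (.succ (.mul (.succ (v 0)) (v 3))))

def lt {n : ℕ} (a b : Tm n) : Fm n := ltF.subst ![a, b]
def mem {n : ℕ} (a s : Tm n) : Fm n := memF.subst ![a, s]

/-- `x` is the code of a term with variables below `n`; free variables `n, x`. -/
def tmF : Fm 2 :=
  .ex <| mem (v 1) (v 2) ⋏ .all (mem (v 3) (v 2) ⟹
    .ex (lt (v 4) (v 0) ⋏ v 3 ≐ dVar (v 4))
    ⋎ v 3 ≐ dZero
    ⋎ .ex (mem (v 4) (v 2) ⋏ v 3 ≐ dSucc (v 4))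
    ⋎ .ex (.ex (mem (v 4) (v 2) ⋏ mem (v 5) (v 2) ⋏
        (v 3 ≐ dAdd (v 4) (v 5) ⋎ v 3 ≐ dMul (v 4) (v 5)))))

def isTm {n : ℕ} (k x : Tm n) : Fm n := tmF.subst ![k, x]

/-- `CT(x)`: `x` is the code of a closed term. -/
def isCT {n : ℕ} (x : Tm n) : Fm n := isTm (nm 0) x

/-- `x` is the code of a formula with free variables below `n`; free variables `n, x`. -/
def fmF : Fm 2 :=
  .ex <| mem (dPr (v 0) (v 1)) (v 2) ⋏ .all (.all (mem (dPr (v 3) (v 4)) (v 2) ⟹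
    .ex (.ex (isTm (v 3) (v 5) ⋏ isTm (v 3) (v 6) ⋏ v 4 ≐ dEq (v 5) (v 6)))
    ⋎ .ex (isTm (v 3) (v 5) ⋏ v 4 ≐ dTr (v 5))
    ⋎ .ex (mem (dPr (v 3) (v 5)) (v 2) ⋏ v 4 ≐ dNeg (v 5))
    ⋎ .ex (.ex (mem (dPr (v 3) (v 5)) (v 2) ⋏ mem (dPr (v 3) (v 6)) (v 2) ⋏
        (v 4 ≐ dOr (v 5) (v 6) ⋎ v 4 ≐ dAnd (v 5) (v 6))))
    ⋎ .ex (mem (dPr (.succ (v 3)) (v 5)) (v 2) ⋏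
        (v 4 ≐ dAll (v 5) ⋎ v 4 ≐ dEx (v 5)))))

def isFm {n : ℕ} (k x : Tm n) : Fm n := fmF.subst ![k, x]

/-- `Sent(x)`: `x` is the code of a sentence. -/
def isSent {n : ℕ} (x : Tm n) : Fm n := isFm (nm 0) x

/-- `t° = y`: `t` is the code of a closed term with value `y`; free variables `t, y`. -/
def valF : Fm 2 :=
  .ex <| mem (dPr (v 0) (v 1)) (v 2) ⋏ .all (.all (mem (dPr (v 3) (v 4)) (v 2) ⟹
    (v 3 ≐ dZero ⋏ v 4 ≐ .zero)
    ⋎ .ex (.ex (mem (dPr (v 5) (v 6)) (v 2) ⋏ v 3 ≐ dSucc (v 5) ⋏ v 4 ≐ .succ (v 6)))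
    ⋎ .ex (.ex (.ex (.ex (mem (dPr (v 5) (v 6)) (v 2) ⋏ mem (dPr (v 7) (v 8)) (v 2) ⋏
        ((v 3 ≐ dAdd (v 5) (v 7) ⋏ v 4 ≐ .add (v 6) (v 8))
        ⋎ (v 3 ≐ dMul (v 5) (v 7) ⋏ v 4 ≐ .mul (v 6) (v 8)))))))))

def isVal {n : ℕ} (t y : Tm n) : Fm n := valF.subst ![t, y]

/-- `y` is the code of the numeral of `x`; free variables `x, y`. -/
def numF : Fm 2 :=
  .ex <| mem (dPr (v 0) (v 1)) (v 2) ⋏ .all (.all (mem (dPr (v 3) (v 4)) (v 2) ⟹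
    (v 3 ≐ .zero ⋏ v 4 ≐ dZero)
    ⋎ .ex (.ex (mem (dPr (v 5) (v 6)) (v 2) ⋏ v 3 ≐ .succ (v 5) ⋏ v 4 ≐ dSucc (v 6)))))

def isNum {n : ℕ} (x y : Tm n) : Fm n := numF.subst ![x, y]

/-- `z` results from the (code of a) term or formula `x` by replacing the variables according to the
clause `cl`, where `cl(n, t, i, w)` says that the variable `i` is replaced by the term `w`; free variables
`n, t, x, z`. -/
def replF (cl : Fm 4) : Fm 4 :=
  .ex <| mem (dPr (v 2) (v 3)) (v 4) ⋏ .all (.all (mem (dPr (v 5) (v 6)) (v 4) ⟹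
    .ex (v 5 ≐ dVar (v 7) ⋏ cl.subst ![v 0, v 1, v 7, v 6])
    ⋎ (v 5 ≐ dZero ⋏ v 6 ≐ dZero)
    ⋎ .ex (.ex (mem (dPr (v 7) (v 8)) (v 4) ⋏
        ((v 5 ≐ dSucc (v 7) ⋏ v 6 ≐ dSucc (v 8))
        ⋎ (v 5 ≐ dTr (v 7) ⋏ v 6 ≐ dTr (v 8))
        ⋎ (v 5 ≐ dNeg (v 7) ⋏ v 6 ≐ dNeg (v 8))
        ⋎ (v 5 ≐ dAll (v 7) ⋏ v 6 ≐ dAll (v 8))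
        ⋎ (v 5 ≐ dEx (v 7) ⋏ v 6 ≐ dEx (v 8)))))
    ⋎ .ex (.ex (.ex (.ex (mem (dPr (v 7) (v 8)) (v 4) ⋏ mem (dPr (v 9) (v 10)) (v 4) ⋏
        ((v 5 ≐ dAdd (v 7) (v 9) ⋏ v 6 ≐ dAdd (v 8) (v 10))
        ⋎ (v 5 ≐ dMul (v 7) (v 9) ⋏ v 6 ≐ dMul (v 8) (v 10))
        ⋎ (v 5 ≐ dEq (v 7) (v 9) ⋏ v 6 ≐ dEq (v 8) (v 10))
        ⋎ (v 5 ≐ dOr (v 7) (v 9) ⋏ v 6 ≐ dOr (v 8) (v 10))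
        ⋎ (v 5 ≐ dAnd (v 7) (v 9) ⋏ v 6 ≐ dAnd (v 8) (v 10)))))))))

/-- Substitution of `t` for the variable `n`; the variables above `n` move down by one (they are the
bound variables of a formula in `Fm (n + 1)`). -/
def instCl : Fm 4 :=
  (lt (v 2) (v 0) ⋏ v 3 ≐ dVar (v 2))
  ⋎ (v 2 ≐ v 0 ⋏ v 3 ≐ v 1)
  ⋎ .ex (v 2 ≐ .succ (.add (v 0) (v 4)) ⋏ v 3 ≐ dVar (.add (v 0) (v 4)))

/-- A dummy variable `n` is added; the variables from `n` on move up by one. -/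
def liftCl : Fm 4 :=
  (lt (v 2) (v 0) ⋏ v 3 ≐ dVar (v 2))
  ⋎ .ex (v 2 ≐ .add (v 0) (v 4) ⋏ v 3 ≐ dVar (.succ (v 2)))

/-- The variable `n` is replaced by its successor. -/
def succCl : Fm 4 :=
  (v 2 ≐ v 0 ⋏ v 3 ≐ dSucc (dVar (v 0)))
  ⋎ (.neg (v 2 ≐ v 0) ⋏ v 3 ≐ dVar (v 2))

/-- `z = #φ(t)` for `x = #φ`, `φ` a formula with free variables up to `k`. -/
def isInst {n : ℕ} (k t x z : Tm n) : Fm n := (replF instCl).subst ![k, t, x, z]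

/-- `z = #φ(t)` for `x = #φ`, `φ` a formula with one free variable and `t` (the code of) a closed term. -/
def isSub {n : ℕ} (x t z : Tm n) : Fm n := isInst (nm 0) t x z

def isLift {n : ℕ} (k x z : Tm n) : Fm n := (replF liftCl).subst ![k, .zero, x, z]

def isInstSucc {n : ℕ} (k x z : Tm n) : Fm n := (replF succCl).subst ![k, .zero, x, z]

/-- `y` is (the code of) a logical axiom with free variables below `n`; free variables `n, y`. -/
def logAxF : Fm 2 :=
  .ex (.ex (.ex (isFm (v 0) (v 2) ⋏ isFm (v 0) (v 3) ⋏ isFm (v 0) (v 4) ⋏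
    (v 1 ≐ dImp (v 2) (dImp (v 3) (v 2))
    ⋎ v 1 ≐ dImp (dImp (v 2) (dImp (v 3) (v 4))) (dImp (dImp (v 2) (v 3)) (dImp (v 2) (v 4)))
    ⋎ v 1 ≐ dImp (dImp (dNeg (v 2)) (dNeg (v 3))) (dImp (v 3) (v 2))
    ⋎ v 1 ≐ dImp (dAnd (v 2) (v 3)) (v 2)
    ⋎ v 1 ≐ dImp (dAnd (v 2) (v 3)) (v 3)
    ⋎ v 1 ≐ dImp (v 2) (dImp (v 3) (dAnd (v 2) (v 3)))
    ⋎ v 1 ≐ dImp (v 2) (dOr (v 2) (v 3))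
    ⋎ v 1 ≐ dImp (v 3) (dOr (v 2) (v 3))
    ⋎ v 1 ≐ dImp (dImp (v 2) (v 4)) (dImp (dImp (v 3) (v 4)) (dImp (dOr (v 2) (v 3)) (v 4)))))))
  ⋎ .ex (.ex (.ex (isFm (.succ (v 0)) (v 2) ⋏ isTm (v 0) (v 3) ⋏ isInst (v 0) (v 3) (v 2) (v 4) ⋏
    (v 1 ≐ dImp (dAll (v 2)) (v 4) ⋎ v 1 ≐ dImp (v 4) (dEx (v 2))))))
  ⋎ .ex (isTm (v 0) (v 2) ⋏ v 1 ≐ dEq (v 2) (v 2))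
  ⋎ .ex (.ex (.ex (.ex (.ex (isFm (.succ (v 0)) (v 2) ⋏ isTm (v 0) (v 3) ⋏ isTm (v 0) (v 4) ⋏
    isInst (v 0) (v 3) (v 2) (v 5) ⋏ isInst (v 0) (v 4) (v 2) (v 6) ⋏
    v 1 ≐ dImp (dEq (v 3) (v 4)) (dImp (v 5) (v 6)))))))

/-- `y` is (the code of) an arithmetical axiom with free variables below `n`; free variables `n, y`. -/
def arithAxF : Fm 2 :=
  .ex (.ex (isTm (v 0) (v 2) ⋏ isTm (v 0) (v 3) ⋏
    (v 1 ≐ dNeg (dEq (dSucc (v 2)) dZero)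
    ⋎ v 1 ≐ dImp (dEq (dSucc (v 2)) (dSucc (v 3))) (dEq (v 2) (v 3))
    ⋎ v 1 ≐ dEq (dAdd (v 2) dZero) (v 2)
    ⋎ v 1 ≐ dEq (dAdd (v 2) (dSucc (v 3))) (dSucc (dAdd (v 2) (v 3)))
    ⋎ v 1 ≐ dEq (dMul (v 2) dZero) dZero
    ⋎ v 1 ≐ dEq (dMul (v 2) (dSucc (v 3))) (dAdd (dMul (v 2) (v 3)) (v 2)))))
  ⋎ .ex (.ex (.ex (isFm (.succ (v 0)) (v 2) ⋏ isInst (v 0) dZero (v 2) (v 3) ⋏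
    isInstSucc (v 0) (v 2) (v 4) ⋏
    v 1 ≐ dImp (dAnd (v 3) (dAll (dImp (v 2) (v 4)))) (dAll (v 2)))))

/-- `Pr_PAT(x)`: there is a finite set `s` of triples `⟨r, ⟨n, y⟩⟩` in which every `y` is an axiom with
free variables below `n` or follows by a rule from entries of smaller rank `r`, and `s` contains some
`⟨r, ⟨0, x⟩⟩`; free variable `x`. -/
def provF : Fm 1 :=
  .ex <| .ex (mem (dPr (v 2) (dPr (nm 0) (v 0))) (v 1)) ⋏
    .all (.all (.all (mem (dPr (v 2) (dPr (v 3) (v 4))) (v 1) ⟹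
      logAxF.subst ![v 3, v 4]
      ⋎ arithAxF.subst ![v 3, v 4]
      ⋎ .ex (.ex (.ex (lt (v 5) (v 2) ⋏ lt (v 6) (v 2) ⋏
          mem (dPr (v 5) (dPr (v 3) (dImp (v 7) (v 4)))) (v 1) ⋏
          mem (dPr (v 6) (dPr (v 3) (v 7))) (v 1))))
      ⋎ .ex (.ex (.ex (.ex (lt (v 5) (v 2) ⋏ isFm (v 3) (v 6) ⋏ isLift (v 3) (v 6) (v 8) ⋏
          ((mem (dPr (v 5) (dPr (.succ (v 3)) (dImp (v 8) (v 7)))) (v 1) ⋏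
              v 4 ≐ dImp (v 6) (dAll (v 7)))
          ⋎ (mem (dPr (v 5) (dPr (.succ (v 3)) (dImp (v 7) (v 8)))) (v 1) ⋏
              v 4 ≐ dImp (dEx (v 7)) (v 6))))))))))

def isProv {n : ℕ} (x : Tm n) : Fm n := provF.subst ![x]

/-! ### The formulas `ξ` and `ξ*`, with the truth predicate for the set variable -/

/-- `s° = t°`. -/
def evEq {n : ℕ} (s t : Tm n) : Fm n :=
  (Fm.ex (isVal (v 0) (v 2) ⋏ isVal (v 1) (v 2)) : Fm 2).subst ![s, t]

/-- `s° ≠ t°`. -/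
def evNe {n : ℕ} (s t : Tm n) : Fm n :=
  (Fm.ex (.ex (isVal (v 0) (v 2) ⋏ isVal (v 1) (v 3) ⋏ .neg (v 2 ≐ v 3))) : Fm 2).subst ![s, t]

/-- `x ∈ True_0`; free variable `x`. -/
def true0F : Fm 1 :=
  .ex (.ex (isCT (v 1) ⋏ isCT (v 2) ⋏
    ((v 0 ≐ dEq (v 1) (v 2) ⋏ evEq (v 1) (v 2))
    ⋎ (v 0 ≐ dNeg (dEq (v 1) (v 2)) ⋏ evNe (v 1) (v 2)))))

/-- `ξ(x, Tr)`; free variable `x`. -/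
def xiF : Fm 1 :=
  true0F
  ⋎ .ex (v 0 ≐ dNeg (dNeg (v 1)) ⋏ .tr (v 1))
  ⋎ .ex (.ex (v 0 ≐ dOr (v 1) (v 2) ⋏ (.tr (v 1) ⋎ .tr (v 2))))
  ⋎ .ex (.ex (v 0 ≐ dNeg (dOr (v 1) (v 2)) ⋏ (.tr (dNeg (v 1)) ⋏ .tr (dNeg (v 2)))))
  ⋎ .ex (.ex (v 0 ≐ dAnd (v 1) (v 2) ⋏ (.tr (v 1) ⋏ .tr (v 2))))
  ⋎ .ex (.ex (v 0 ≐ dNeg (dAnd (v 1) (v 2)) ⋏ (.tr (dNeg (v 1)) ⋎ .tr (dNeg (v 2)))))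
  ⋎ .ex (v 0 ≐ dAll (v 1) ⋏ .all (isCT (v 2) ⟹ .ex (isSub (v 1) (v 2) (v 3) ⋏ .tr (v 3))))
  ⋎ .ex (v 0 ≐ dNeg (dAll (v 1)) ⋏
      .ex (isCT (v 2) ⋏ .ex (isSub (v 1) (v 2) (v 3) ⋏ .tr (dNeg (v 3)))))
  ⋎ .ex (v 0 ≐ dEx (v 1) ⋏ .ex (isCT (v 2) ⋏ .ex (isSub (v 1) (v 2) (v 3) ⋏ .tr (v 3))))
  ⋎ .ex (v 0 ≐ dNeg (dEx (v 1)) ⋏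
      .all (isCT (v 2) ⟹ .ex (isSub (v 1) (v 2) (v 3) ⋏ .tr (dNeg (v 3)))))
  ⋎ .ex (.ex (isCT (v 1) ⋏ isVal (v 1) (v 2) ⋏ v 0 ≐ dTr (v 1) ⋏ .tr (v 2)))
  ⋎ .ex (.ex (isCT (v 1) ⋏ isVal (v 1) (v 2) ⋏ v 0 ≐ dNeg (dTr (v 1)) ⋏
      (.tr (dNeg (v 2)) ⋎ .neg (isSent (v 2)))))

/-- `ξ*(x, Tr)`; free variable `x`. -/
def xiStarF : Fm 1 :=
  xiF
  ⋎ .ex (.ex (isCT (v 1) ⋏ isVal (v 1) (v 2) ⋏ v 0 ≐ v 2 ⋏ isSent (v 2) ⋏ .tr (dTr (v 1))))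
  ⋎ .ex (.ex (isCT (v 1) ⋏ isVal (v 1) (v 2) ⋏ v 0 ≐ dNeg (v 2) ⋏ isSent (dNeg (v 2)) ⋏
      .tr (dNeg (dTr (v 1)))))

def xiStar {n : ℕ} (x : Tm n) : Fm n := xiStarF.subst ![x]

/-- `Tr⌜φ(ẋ)⌝`: the result of substituting the numeral of `x` in `φ` is true. -/
def trDot {n : ℕ} (φ : Fm 1) (x : Tm n) : Fm n :=
  (Fm.ex (.ex (isNum (v 0) (v 1) ⋏ isSub (quo φ) (v 1) (v 2) ⋏ .tr (v 2))) : Fm 1).subst ![x]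

/-! ## The theories -/

/-- `∀s,t (Tr(s = t) ↔ s° = t°) ∧ ∀s,t (Tr(s ≠ t) ↔ s° ≠ t°)`. -/
def IT1 : Sentence :=
  .all (.all (isCT (v 0) ⋏ isCT (v 1) ⟹ (.tr (dEq (v 0) (v 1)) ⟺ evEq (v 0) (v 1))))
  ⋏ .all (.all (isCT (v 0) ⋏ isCT (v 1) ⟹ (.tr (dNeg (dEq (v 0) (v 1))) ⟺ evNe (v 0) (v 1))))

/-- `∀x,y (Sent(x ∧ y) → (Tr x ∧ Tr y → Tr(x ∧ y)))`. -/
def IT2 : Sentence :=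
  .all (.all (isSent (dAnd (v 0) (v 1)) ⟹
    (.tr (v 0) ⋏ .tr (v 1) ⟹ .tr (dAnd (v 0) (v 1)))))

/-- `∀x,y (Sent(x ∨ y) → (Tr x ∨ Tr y ∨ ∃z (ξ*(z, Tr) ∧ Pr(z → x ∨ y)) ↔ Tr(x ∨ y)))`. -/
def IT3 : Sentence :=
  .all (.all (isSent (dOr (v 0) (v 1)) ⟹
    (.tr (v 0) ⋎ .tr (v 1) ⋎ .ex (xiStar (v 2) ⋏ isProv (dImp (v 2) (dOr (v 0) (v 1))))
      ⟺ .tr (dOr (v 0) (v 1)))))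

/-- `∀x,v (Sent(∀v x) → (∀t Tr(x(t/v)) → Tr(∀v x)))`. -/
def IT4 : Sentence :=
  .all (isSent (dAll (v 0)) ⟹
    (.all (isCT (v 1) ⟹ .ex (isSub (v 0) (v 1) (v 2) ⋏ .tr (v 2))) ⟹ .tr (dAll (v 0))))

/-- `∀x,v (Sent(∃v x) → (∃t Tr(x(t/v)) ∨ ∃w (ξ*(w, Tr) ∧ Pr(w → ∃v x)) ↔ Tr(∃v x)))`. -/
def IT5 : Sentence :=
  .all (isSent (dEx (v 0)) ⟹
    (.ex (isCT (v 1) ⋏ .ex (isSub (v 0) (v 1) (v 2) ⋏ .tr (v 2)))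
      ⋎ .ex (xiStar (v 1) ⋏ isProv (dImp (v 1) (dEx (v 0))))
      ⟺ .tr (dEx (v 0))))

/-- `∀x (Tr x ↔ Tr(Tr ẋ))`. -/
def IT6 : Sentence :=
  .all (.all (isNum (v 0) (v 1) ⟹ (.tr (v 0) ⟺ .tr (dTr (v 1)))))

/-- `∀x (Tr(¬x) ∨ ¬Sent(x) ↔ Tr(¬Tr ẋ))`. -/
def IT7 : Sentence :=
  .all (.all (isNum (v 0) (v 1) ⟹
    (.tr (dNeg (v 0)) ⋎ .neg (isSent (v 0)) ⟺ .tr (dNeg (dTr (v 1))))))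

/-- `∀x,y (Tr x ∧ Pr(x → y) → Tr y)`. -/
def IT8 : Sentence :=
  .all (.all (.tr (v 0) ⋏ isProv (dImp (v 0) (v 1)) ⟹ .tr (v 1)))

/-- `∀x (Tr(¬x) → ¬Tr x)`. -/
def IT9 : Sentence := .all (.tr (dNeg (v 0)) ⟹ .neg (.tr (v 0)))

/-- `Tr⌜∀x (Tr x → Sent(x))⌝`. -/
def IT10 : Sentence := .tr (quo (.all (.tr (v 0) ⟹ isSent (v 0)) : Sentence))

/-- The theory IT*. -/
def ITstar : Set Sentence := PAT ∪ {IT1, IT2, IT3, IT4, IT5, IT6, IT7, IT8, IT9, IT10}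

/-- `∀x Tr⌜¬(Tr ẋ ∧ Tr ¬ẋ)⌝`. -/
def consAx : Sentence := .all (trDot (.neg (.tr (v 0) ⋏ .tr (dNeg (v 0)))) (v 0))

/-- `∀x (Sent(x) → Tr⌜¬Tr ẋ ↔ Tr ¬ẋ⌝)`. -/
def comAx : Sentence :=
  .all (isSent (v 0) ⟹ trDot (.neg (.tr (v 0)) ⟺ .tr (dNeg (v 0))) (v 0))

/-- The theories IT*_c and IT*_mc. -/
def ITstarC : Set Sentence := ITstar ∪ {consAx}
def ITstarMC : Set Sentence := ITstar ∪ {comAx}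

/-- The theory `T` is ℕ-categorical for the class `C`: the sets `S` in `C` are exactly those for which
`(ℕ, S)` is a model of `T`. -/
def NCategorical (T : Set Sentence) (C : Set ℕ → Prop) : Prop :=
  ∀ S : Set ℕ, C S ↔ Models S T

end SupTruth

/-!
The three equivalences are instances of one, `fixedPoint_iff_models`: for any set `E` of additional
premises, the consistent fixed points of the operator `Theta E` are exactly the models of IT* that
contain `E`.

The semantic core is short. A fixed point `S` contains everything that satisfies `ξ*(·, S)` and is closed
under provability in PAT. If `#φ ∈ S`, then `#Tr t ∈ S` for every closed term `t` with value `#φ`, so `φ`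
satisfies `ξ*` by the downward clause for `Tr`; hence the disjuncts `∃z (ξ*(z, Tr) ∧ Pr(z → ·))` of IT3
and IT5 are satisfied by the sentence itself, also in the presence of additional premises. The downward
clauses and consistency yield IT6, IT7 and IT9. For IT10, `S` contains every true sentence without `Tr`,
since it is closed under the clauses of `ξ` (`TrFree.code_mem`); so for each closed term `t` it contains
either `Sent(t)`, or `¬Tr t` if the value of `t` is not the code of a sentence. Conversely, in a model of
IT* the axioms give back each clause of `ξ*`; here PAT proves that closed terms of equal value are equal
(`Prov.eq_of_ev`), which reduces `Tr t` to `Tr` of a numeral. IT6, IT7 and IT9 exclude from `S` all numbers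
that are not codes of sentences, and IT6 yields that every element of `S` satisfies `ξ*`.

Beyond this, the formulas of the object language have to be evaluated in the standard model. Each
syntactic notion is expressed there by the existence of a code of a finite set in which every element
follows by a step from elements of the set. As every finite set of numbers has a code (`exists_code`),
such a formula defines the least predicate closed under the step when the step decreases a measure; the
only general facts needed are `exists_mem_iff_ind` and the one-step unfolding `ind_iff`.
-/

namespace SupTruth

/-! ### Substitution -/

theorem snoc_vecCons {α : Type*} {n : ℕ} (a : α) (f : Fin n → α) (c : α) :
    (Fin.snoc (Matrix.vecCons a f) c : Fin (n + 1 + 1) → α) =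
      Matrix.vecCons a (Fin.snoc f c : Fin (n + 1) → α) :=
  (Fin.cons_snoc_eq_snoc_cons (β := α) a f c).symm

theorem snoc_vecEmpty {α : Type*} (f : Fin 0 → α) (c : α) :
    (Fin.snoc f c : Fin 1 → α) = ![c] := by
  funext i
  refine Fin.lastCases ?_ (fun i => i.elim0) i
  simp only [Fin.snoc_last]
  rfl

theorem Tm.subst_subst {n m k : ℕ} (σ : Fin n → Tm m) (τ : Fin m → Tm k) (t : Tm n) :
    (t.subst σ).subst τ = t.subst fun i => (σ i).subst τ := by
  induction t <;> simp_all [Tm.subst]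

@[simp] theorem Tm.subst_var {n : ℕ} (t : Tm n) : t.subst Tm.var = t := by
  induction t <;> simp_all [Tm.subst]

theorem Tm.lift_subst {n m : ℕ} (t : Tm n) (σ : Fin (n + 1) → Tm m) :
    t.lift.subst σ = t.subst fun i => σ i.castSucc := by
  simp [Tm.lift, Tm.subst_subst, Tm.subst]

theorem liftSubst_comp {n m k : ℕ} (σ : Fin n → Tm m) (τ : Fin m → Tm k) :
    (fun i => (liftSubst σ i).subst (liftSubst τ)) = liftSubst fun i => (σ i).subst τ := by
  funext i
  refine Fin.lastCases ?_ (fun i => ?_) i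
  · simp [liftSubst, Tm.subst]
  · simp only [liftSubst, Fin.snoc_castSucc, Tm.lift_subst]
    simp [Tm.lift, Tm.subst_subst]

theorem liftSubst_var {n : ℕ} : liftSubst (Tm.var : Fin n → Tm n) = Tm.var := by
  funext i
  refine Fin.lastCases ?_ (fun i => ?_) i <;> simp [liftSubst, Tm.lift, Tm.subst]

theorem Fm.subst_subst {n m k : ℕ} (σ : Fin n → Tm m) (τ : Fin m → Tm k) (φ : Fm n) :
    (φ.subst σ).subst τ = φ.subst fun i => (σ i).subst τ := by
  induction φ generalizing m k <;>
    simp_all [Fm.subst, Tm.subst_subst, liftSubst_comp]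

@[simp] theorem Fm.subst_var {n : ℕ} (φ : Fm n) : φ.subst Tm.var = φ := by
  induction φ <;> simp_all [Fm.subst, liftSubst_var]

/-- Substituting below a binder and then instantiating the bound variable is one simultaneous
substitution. -/
theorem Fm.subst_liftSubst_inst {n m : ℕ} (φ : Fm (n + 1)) (σ : Fin n → Tm m) (t : Tm m) :
    (φ.subst (liftSubst σ)).inst t = φ.subst (Fin.snoc σ t) := by
  rw [Fm.inst, Fm.subst_subst]
  congr 1
  funext i
  refine Fin.lastCases ?_ (fun i => ?_) i <;> simp [liftSubst, Tm.lift_subst, Tm.subst]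

/-! ### Satisfaction -/

theorem Tm.val_subst {n m : ℕ} (σ : Fin n → Tm m) (e : Fin m → ℕ) (t : Tm n) :
    (t.subst σ).val e = t.val fun i => (σ i).val e := by
  induction t <;> simp_all [Tm.subst, Tm.val]

theorem liftSubst_val {n m : ℕ} (σ : Fin n → Tm m) (e : Fin m → ℕ) (a : ℕ) :
    (fun i => (liftSubst σ i).val (Fin.snoc e a : Fin (m + 1) → ℕ)) =
      (Fin.snoc (fun i => (σ i).val e) a : Fin (n + 1) → ℕ) := by
  funext i
  refine Fin.lastCases ?_ (fun i => ?_) i <;> simp [liftSubst, Tm.lift, Tm.val_subst, Tm.val]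

theorem Fm.sat_subst (S : Set ℕ) {n m : ℕ} (σ : Fin n → Tm m) (φ : Fm n) (e : Fin m → ℕ) :
    (φ.subst σ).Sat S e ↔ φ.Sat S fun i => (σ i).val e := by
  induction φ generalizing m <;>
    simp_all [Fm.subst, Fm.Sat, Tm.val_subst, liftSubst_val]

theorem Fm.sat_lift (S : Set ℕ) {n : ℕ} (φ : Fm n) (e : Fin n → ℕ) (a : ℕ) :
    φ.lift.Sat S (Fin.snoc e a : Fin (n + 1) → ℕ) ↔ φ.Sat S e := by
  simp [Fm.lift, Fm.sat_subst, Tm.val]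

theorem snoc_var_val {n : ℕ} (e : Fin n → ℕ) (t : Tm n) :
    (fun i => ((Fin.snoc Tm.var t : Fin (n + 1) → Tm n) i).val e) =
      (Fin.snoc e (t.val e) : Fin (n + 1) → ℕ) := by
  funext i
  refine Fin.lastCases ?_ (fun i => ?_) i <;> simp [Tm.val]

theorem Fm.sat_inst (S : Set ℕ) {n : ℕ} (φ : Fm (n + 1)) (t : Tm n) (e : Fin n → ℕ) :
    (φ.inst t).Sat S e ↔ φ.Sat S (Fin.snoc e (t.val e) : Fin (n + 1) → ℕ) := by
  rw [Fm.inst, Fm.sat_subst, snoc_var_val]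

theorem Fm.sat_instSucc (S : Set ℕ) {n : ℕ} (φ : Fm (n + 1)) (e : Fin n → ℕ) (a : ℕ) :
    φ.instSucc.Sat S (Fin.snoc e a : Fin (n + 1) → ℕ) ↔
      φ.Sat S (Fin.snoc e (a + 1) : Fin (n + 1) → ℕ) := by
  rw [Fm.instSucc, Fm.sat_subst]
  have : (fun i => ((Fin.snoc (fun i : Fin n => Tm.var i.castSucc) (.succ (.var (Fin.last n))) :
      Fin (n + 1) → Tm (n + 1)) i).val (Fin.snoc e a : Fin (n + 1) → ℕ)) =
      (Fin.snoc e (a + 1) : Fin (n + 1) → ℕ) := by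
    funext i
    refine Fin.lastCases ?_ (fun i => ?_) i <;> simp [Tm.val]
  rw [this]

theorem Fm.sat_imp (S : Set ℕ) {n : ℕ} (φ ψ : Fm n) (e : Fin n → ℕ) :
    (φ ⟹ ψ).Sat S e ↔ (φ.Sat S e → ψ.Sat S e) := by
  simp only [Fm.imp, Fm.Sat, imp_iff_not_or]

theorem Fm.sat_iff (S : Set ℕ) {n : ℕ} (φ ψ : Fm n) (e : Fin n → ℕ) :
    (φ ⟺ ψ).Sat S e ↔ (φ.Sat S e ↔ ψ.Sat S e) := by
  simp only [Fm.iff, Fm.Sat, Fm.sat_imp, iff_def]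

@[simp] theorem Tm.val_nm {n : ℕ} (e : Fin n → ℕ) (k : ℕ) : (nm k : Tm n).val e = k := by
  induction k <;> simp_all [nm, Tm.val]

@[simp] theorem ev_nm (k : ℕ) : ev (nm k) = k := Tm.val_nm _ k

/-- `(ℕ, S)` is a model of `PAT`, whatever `S` is. -/
theorem Prov.sound (S : Set ℕ) {n : ℕ} {φ : Fm n} (h : Prov n φ) : ∀ e, φ.Sat S e := by
  induction h with
  | log h =>
    intro e
    cases h with
    | allElim a t => simpa only [Fm.sat_imp, Fm.Sat, Fm.sat_inst] using fun h => h _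
    | exIntro a t => simpa only [Fm.sat_imp, Fm.Sat, Fm.sat_inst] using fun h => ⟨_, h⟩
    | eqSubst a t u =>
      simp only [Fm.sat_imp, Fm.Sat, Fm.sat_inst]
      intro h
      rw [h]
      exact id
    | eqRefl t => rfl
    | _ => simp only [Fm.sat_imp, Fm.Sat]; tauto
  | arith h =>
    intro e
    cases h <;> simp only [Fm.sat_imp, Fm.Sat, Fm.sat_inst, Tm.val]
    case succNeZero => exact Nat.succ_ne_zero _
    case succInj => exact Nat.succ.inj
    case addZero => rfl
    case addSucc => rfl
    case mulZero => rfl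
    case mulSucc => rfl
    rintro ⟨h0, h1⟩ a
    induction a with
    | zero => exact h0
    | succ a ih => exact (Fm.sat_instSucc S _ e a).1 (h1 a ih)
  | mp _ _ ih1 ih2 => exact fun e => (Fm.sat_imp ..).1 (ih1 e) (ih2 e)
  | allRule _ ih =>
    intro e
    rw [Fm.sat_imp]
    exact fun h a => (Fm.sat_imp ..).1 (ih (Fin.snoc e a)) ((Fm.sat_lift ..).2 h)
  | exRule _ ih =>
    intro e
    rw [Fm.sat_imp]
    rintro ⟨a, h⟩
    exact (Fm.sat_lift ..).1 ((Fm.sat_imp ..).1 (ih (Fin.snoc e a)) h)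

/-! ### Codes -/

theorem pr_inj {a b c d : ℕ} : pr a b = pr c d ↔ a = c ∧ b = d := by
  constructor
  · intro h
    unfold pr at h
    have hs : a + b = c + d := by
      rcases lt_trichotomy (a + b) (c + d) with h' | h' | h'
      · nlinarith
      · exact h'
      · nlinarith
    rw [hs] at h
    omega
  · rintro ⟨rfl, rfl⟩; rfl

theorem lt_pr {a : ℕ} (ha : a ≠ 0) (b : ℕ) : b < pr a b := by
  unfold pr
  have := Nat.pos_of_ne_zero ha
  nlinarith

theorem le_pr_left (a b : ℕ) : a ≤ pr a b := by unfold pr; omega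

theorem le_pr_right (a b : ℕ) : b ≤ pr a b := by unfold pr; nlinarith

theorem Tm.code_injective {n : ℕ} : Function.Injective (Tm.code : Tm n → ℕ) := by
  intro t
  induction t with
  | var i => intro u h; cases u <;> simp_all [Tm.code, pr_inj, Fin.ext_iff]
  | zero => intro u h; cases u <;> simp_all [Tm.code, pr_inj]
  | succ t ih =>
    intro u h
    cases u <;> simp [Tm.code, pr_inj] at h
    rw [ih h]
  | add t t' ih ih' | mul t t' ih ih' =>
    intro u h
    cases u <;> simp [Tm.code, pr_inj] at h
    rw [ih h.1, ih' h.2]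

theorem Fm.code_injective {n : ℕ} : Function.Injective (Fm.code : Fm n → ℕ) := by
  intro φ
  induction φ with
  | eq t u =>
    intro ψ h
    cases ψ <;> simp [Fm.code, pr_inj] at h
    rw [Tm.code_injective h.1, Tm.code_injective h.2]
  | tr t =>
    intro ψ h
    cases ψ <;> simp [Fm.code, pr_inj] at h
    rw [Tm.code_injective h]
  | or φ φ' ih ih' | and φ φ' ih ih' =>
    intro ψ h
    cases ψ <;> simp [Fm.code, pr_inj] at h
    rw [ih h.1, ih' h.2]
  | neg φ ih | all φ ih | ex φ ih =>
    intro ψ h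
    cases ψ <;> simp [Fm.code, pr_inj] at h
    rw [ih h]

theorem Fm.code_inj {n : ℕ} {φ ψ : Fm n} : φ.code = ψ.code ↔ φ = ψ := Fm.code_injective.eq_iff

/-! ### Coding of finite sets -/

/-- The relation on numbers that `memF` defines: `y` belongs to the finite set coded by `s`. -/
def Mem (y s : ℕ) : Prop :=
  ∃ a b l d q, s = pr a (pr b l) ∧ y + d = l ∧ a = q * ((y + 1) * b + 1)

theorem Mem.le {y s : ℕ} (h : Mem y s) : y ≤ s := by
  obtain ⟨a, b, l, d, q, rfl, rfl, _⟩ := h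
  exact (Nat.le_add_right y d).trans ((le_pr_right _ _).trans (le_pr_right _ _))

theorem coprime_moduli {l x y : ℕ} (hx : x ≤ l) (hy : y ≤ l) (hxy : x ≠ y) :
    Nat.Coprime ((x + 1) * l.factorial + 1) ((y + 1) * l.factorial + 1) := by
  wlog hlt : x < y generalizing x y
  · exact (this hy hx hxy.symm (by omega)).symm
  refine Nat.Coprime.symm (Nat.coprime_of_dvd fun p hp h1 h2 => ?_)
  have h3 : p ∣ (y - x) * l.factorial := by
    have h := Nat.dvd_sub h1 h2
    have e : (y + 1) * l.factorial + 1 - ((x + 1) * l.factorial + 1) =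
        (y - x) * l.factorial := by
      rw [Nat.add_sub_add_right, ← Nat.sub_mul, Nat.add_sub_add_right]
    rwa [e] at h
  have h4 : p ∣ l.factorial := by
    rcases hp.dvd_mul.1 h3 with h | h
    · exact (hp.dvd_factorial).2 ((Nat.le_of_dvd (by omega) h).trans (by omega))
    · exact h
  have h5 : p ∣ 1 := (Nat.dvd_add_right (h4.mul_left (x + 1))).1 h2
  exact hp.one_lt.ne' (Nat.dvd_one.1 h5)

/-- Every finite set has a code: with `l` the maximum of the set and `b = l!`, the moduli
`1 + (y + 1) * b` for `y ≤ l` are pairwise coprime, so their product over the set is divisible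
by no other of them. -/
theorem exists_code (G : Finset ℕ) : ∃ s, ∀ y, Mem y s ↔ y ∈ G := by
  set l := G.sup id with hl
  have hle : ∀ y ∈ G, y ≤ l := fun y hy => Finset.le_sup (f := id) hy
  refine ⟨pr (∏ y ∈ G, ((y + 1) * l.factorial + 1)) (pr l.factorial l), fun y => ⟨?_, fun hy => ?_⟩⟩
  · rintro ⟨a, b, l', d, q, h, hd, ha⟩
    obtain ⟨rfl, rfl, rfl⟩ : _ = a ∧ _ = b ∧ _ = l' := by simpa only [pr_inj] using h
    by_contra hy
    have hc : Nat.Coprime ((y + 1) * l.factorial + 1) (∏ y ∈ G, ((y + 1) * l.factorial + 1)) :=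
      Nat.Coprime.prod_right fun x hx =>
        coprime_moduli (by omega) (hle x hx) fun h => hy (h ▸ hx)
    have := Nat.Coprime.eq_one_of_dvd hc ⟨q, ha.trans (Nat.mul_comm _ _)⟩
    exact (Nat.mul_pos (Nat.succ_pos y) l.factorial_pos).ne' (Nat.succ.inj this)
  · obtain ⟨q, hq⟩ := Finset.dvd_prod_of_mem (fun y => (y + 1) * l.factorial + 1) hy
    exact ⟨_, _, _, l - y, q, rfl, by have := hle y hy; omega, hq.trans (Nat.mul_comm _ _)⟩

/-! ### Inductive definitions by finite closed sets -/

/-- A condition on a predicate that holds as soon as it holds for a finite part of the predicate. -/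
def Finitary {α : Type*} (Φ : (α → Prop) → Prop) : Prop :=
  ∀ P, Φ P ↔ ∃ F : Finset α, (∀ x ∈ F, P x) ∧ Φ fun x => x ∈ F

section Finitary
variable {α : Type*} {Φ Ψ : (α → Prop) → Prop}

theorem Finitary.mono (h : Finitary Φ) {P Q : α → Prop} (hPQ : ∀ x, P x → Q x) (hP : Φ P) : Φ Q :=
  let ⟨F, hF, hΦ⟩ := (h P).1 hP
  (h Q).2 ⟨F, fun x hx => hPQ x (hF x hx), hΦ⟩

theorem Finitary.const (p : Prop) : Finitary fun _ : α → Prop => p := fun _ =>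
  ⟨fun h => ⟨∅, by simp, h⟩, fun ⟨_, _, h⟩ => h⟩

theorem Finitary.atom (a : α) : Finitary fun P : α → Prop => P a := fun _ =>
  ⟨fun h => ⟨{a}, by simpa using h, by simp⟩, fun ⟨_, hF, h⟩ => hF a h⟩

theorem Finitary.and (hΦ : Finitary Φ) (hΨ : Finitary Ψ) : Finitary fun P => Φ P ∧ Ψ P := by
  classical
  intro P
  constructor
  · rintro ⟨h1, h2⟩
    obtain ⟨F, hF, h1⟩ := (hΦ P).1 h1
    obtain ⟨G, hG, h2⟩ := (hΨ P).1 h2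
    refine ⟨F ∪ G, fun x hx => ?_, hΦ.mono (fun x hx => ?_) h1, hΨ.mono (fun x hx => ?_) h2⟩
    · exact (Finset.mem_union.1 hx).elim (hF x) (hG x)
    · exact Finset.mem_union_left _ hx
    · exact Finset.mem_union_right _ hx
  · rintro ⟨F, hF, h1, h2⟩
    exact ⟨hΦ.mono hF h1, hΨ.mono hF h2⟩

theorem Finitary.or (hΦ : Finitary Φ) (hΨ : Finitary Ψ) : Finitary fun P => Φ P ∨ Ψ P := by
  intro P
  constructor
  · rintro (h | h)
    · obtain ⟨F, hF, h⟩ := (hΦ P).1 h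
      exact ⟨F, hF, Or.inl h⟩
    · obtain ⟨F, hF, h⟩ := (hΨ P).1 h
      exact ⟨F, hF, Or.inr h⟩
  · rintro ⟨F, hF, h⟩
    exact h.imp (hΦ.mono hF) (hΨ.mono hF)

theorem Finitary.exists {ι : Type*} {Φ : ι → (α → Prop) → Prop} (h : ∀ i, Finitary (Φ i)) :
    Finitary fun P => ∃ i, Φ i P := by
  intro P
  constructor
  · rintro ⟨i, hi⟩
    obtain ⟨F, hF, hi⟩ := (h i P).1 hi
    exact ⟨F, hF, i, hi⟩
  · rintro ⟨F, hF, i, hi⟩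
    exact ⟨i, (h i).mono hF hi⟩

/-- Membership in a finite set each of whose elements follows by the step from elements of the set. If
the step decreases some measure, this is the predicate inductively defined by the step. -/
def Ind (step : (α → Prop) → α → Prop) (a : α) : Prop :=
  ∃ F : Finset α, a ∈ F ∧ ∀ x ∈ F, step (fun y => y ∈ F) x

theorem ind_iff {step : (α → Prop) → α → Prop} (h : ∀ a, Finitary fun P => step P a) (a : α) :
    Ind step a ↔ step (Ind step) a := by
  classical
  constructor
  · rintro ⟨F, ha, hF⟩
    exact (h a).mono (fun x hx => ⟨F, hx, hF⟩) (hF a ha)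
  · intro ha
    obtain ⟨G, hG, ha⟩ := (h a _).1 ha
    choose! F hx hF using hG
    refine ⟨insert a (G.biUnion F), Finset.mem_insert_self _ _, fun x hx' => ?_⟩
    rcases Finset.mem_insert.1 hx' with rfl | hx'
    · exact (h x).mono (fun y hy =>
        Finset.mem_insert_of_mem (Finset.mem_biUnion.2 ⟨y, hy, hx y hy⟩)) ha
    · obtain ⟨y, hy, hxy⟩ := Finset.mem_biUnion.1 hx'
      exact (h x).mono (fun z hz =>
        Finset.mem_insert_of_mem (Finset.mem_biUnion.2 ⟨y, hy, hz⟩)) (hF y hy x hxy)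

/-- The language quantifies over codes of finite closed sets instead of the sets themselves. -/
theorem exists_mem_iff_ind {enc : α → ℕ} (henc : Function.Injective enc)
    {step : (α → Prop) → α → Prop} {a : α} :
    (∃ s, Mem (enc a) s ∧ ∀ x, Mem (enc x) s → step (fun y => Mem (enc y) s) x) ↔
      Ind step a := by
  classical
  constructor
  · rintro ⟨s, ha, hs⟩
    have hfin : {x | Mem (enc x) s}.Finite :=
      ((Set.finite_Iic s).preimage henc.injOn).subset fun x hx => hx.le
    have he : (fun y => y ∈ hfin.toFinset) = fun y => Mem (enc y) s := by
      funext y; simp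
    refine ⟨hfin.toFinset, by simpa using ha, fun x hx => ?_⟩
    rw [he]
    exact hs x (by simpa using hx)
  · rintro ⟨F, ha, hF⟩
    obtain ⟨s, hs⟩ := exists_code (F.image enc)
    have he : ∀ y, Mem (enc y) s ↔ y ∈ F := fun y => by
      rw [hs, henc.mem_finset_image]
    refine ⟨s, (he a).2 ha, fun x hx => ?_⟩
    have : (fun y => Mem (enc y) s) = fun y => y ∈ F := funext fun y => propext (he y)
    rw [this]
    exact hF x ((he x).1 hx)

end Finitary

/-! ### Evaluation of formulas -/

section Sat
variable (S : Set ℕ) {n : ℕ}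

@[simp] theorem sat_eq (t u : Tm n) (e : Fin n → ℕ) : (t ≐ u).Sat S e ↔ t.val e = u.val e := Iff.rfl
@[simp] theorem sat_tr (t : Tm n) (e : Fin n → ℕ) : (Fm.tr t).Sat S e ↔ t.val e ∈ S := Iff.rfl
@[simp] theorem sat_neg (φ : Fm n) (e : Fin n → ℕ) : (Fm.neg φ).Sat S e ↔ ¬ φ.Sat S e := Iff.rfl
@[simp] theorem sat_or (φ ψ : Fm n) (e : Fin n → ℕ) :
    (φ ⋎ ψ).Sat S e ↔ φ.Sat S e ∨ ψ.Sat S e := Iff.rfl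
@[simp] theorem sat_and (φ ψ : Fm n) (e : Fin n → ℕ) :
    (φ ⋏ ψ).Sat S e ↔ φ.Sat S e ∧ ψ.Sat S e := Iff.rfl
@[simp] theorem sat_all (φ : Fm (n + 1)) (e : Fin n → ℕ) :
    (Fm.all φ).Sat S e ↔ ∀ a, φ.Sat S (Fin.snoc e a : Fin (n + 1) → ℕ) := Iff.rfl
@[simp] theorem sat_ex (φ : Fm (n + 1)) (e : Fin n → ℕ) :
    (Fm.ex φ).Sat S e ↔ ∃ a, φ.Sat S (Fin.snoc e a : Fin (n + 1) → ℕ) := Iff.rfl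

attribute [simp] Fm.sat_imp Fm.sat_iff snoc_vecCons snoc_vecEmpty

@[simp] theorem val_var (e : Fin n → ℕ) (i : Fin n) : (Tm.var i).val e = e i := rfl
@[simp] theorem val_zero (e : Fin n → ℕ) : (Tm.zero : Tm n).val e = 0 := rfl
@[simp] theorem val_succ (e : Fin n → ℕ) (t : Tm n) : (Tm.succ t).val e = t.val e + 1 := rfl
@[simp] theorem val_add (e : Fin n → ℕ) (t u : Tm n) : (Tm.add t u).val e = t.val e + u.val e := rfl
@[simp] theorem val_mul (e : Fin n → ℕ) (t u : Tm n) : (Tm.mul t u).val e = t.val e * u.val e := rfl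
@[simp] theorem val_dPr (e : Fin n → ℕ) (t u : Tm n) : (dPr t u).val e = pr (t.val e) (u.val e) := rfl

attribute [simp] dVar dZero dSucc dAdd dMul dEq dTr dNeg dOr dAnd dAll dEx dImp quo

@[simp] theorem sat_subst_one (φ : Fm 1) (t : Tm n) (e : Fin n → ℕ) :
    (φ.subst ![t]).Sat S e ↔ φ.Sat S ![t.val e] := by
  rw [Fm.sat_subst]
  congr! 1
  funext i
  fin_cases i; rfl

@[simp] theorem sat_subst_two (φ : Fm 2) (t u : Tm n) (e : Fin n → ℕ) :
    (φ.subst ![t, u]).Sat S e ↔ φ.Sat S ![t.val e, u.val e] := by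
  rw [Fm.sat_subst]
  congr! 1
  funext i
  fin_cases i <;> rfl

@[simp] theorem sat_subst_four (φ : Fm 4) (t u w z : Tm n) (e : Fin n → ℕ) :
    (φ.subst ![t, u, w, z]).Sat S e ↔ φ.Sat S ![t.val e, u.val e, w.val e, z.val e] := by
  rw [Fm.sat_subst]
  congr! 1
  funext i
  fin_cases i <;> rfl

@[simp] theorem sat_lt (a b : Tm n) (e : Fin n → ℕ) :
    (lt a b).Sat S e ↔ a.val e < b.val e := by
  simp only [lt, ltF, sat_subst_two, sat_ex, sat_eq, snoc_vecCons, snoc_vecEmpty, val_var, val_succ,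
    val_add, Matrix.cons_val]
  exact ⟨fun ⟨d, hd⟩ => by omega, fun h => ⟨b.val e - a.val e - 1, by omega⟩⟩

@[simp] theorem sat_mem (a s : Tm n) (e : Fin n → ℕ) :
    (mem a s).Sat S e ↔ Mem (a.val e) (s.val e) := by
  simp only [mem, memF, sat_subst_two, sat_ex, sat_and, sat_eq, snoc_vecCons, snoc_vecEmpty, val_var,
    val_succ, val_add, val_mul, val_dPr, Matrix.cons_val]
  exact Iff.rfl

end Sat

/-! ### Terms, formulas and values -/

/-- One step in building (the code of) a term with variables below `n`, as in `tmF`. -/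
def tmStep (n : ℕ) (P : ℕ → Prop) (x : ℕ) : Prop :=
  (∃ i, i < n ∧ x = pr 1 i) ∨ x = pr 2 0 ∨ (∃ a, P a ∧ x = pr 3 a) ∨
    ∃ a b, P a ∧ P b ∧ (x = pr 4 (pr a b) ∨ x = pr 5 (pr a b))

theorem finitary_tmStep (n x : ℕ) : Finitary fun P => tmStep n P x := by
  unfold tmStep
  repeat' first
    | exact .const _ | exact .atom _ | apply Finitary.or | apply Finitary.and
    | refine Finitary.exists fun _ => ?_

/-- `x` is the code of a term with variables below `n`. -/
def IsTm (n x : ℕ) : Prop := ∃ t : Tm n, x = t.code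

theorem ind_tmStep (n x : ℕ) : Ind (tmStep n) x ↔ IsTm n x := by
  constructor
  · induction x using Nat.strong_induction_on with
    | _ x ih =>
      rw [ind_iff (finitary_tmStep n)]
      rintro (⟨i, hi, rfl⟩ | rfl | ⟨a, ha, rfl⟩ | ⟨a, b, ha, hb, rfl | rfl⟩)
      · exact ⟨.var ⟨i, hi⟩, rfl⟩
      · exact ⟨.zero, rfl⟩
      · obtain ⟨t, rfl⟩ := ih a (lt_pr (by simp) a) ha
        exact ⟨.succ t, rfl⟩
      · obtain ⟨t, rfl⟩ := ih a ((le_pr_left a b).trans_lt (lt_pr (by simp) _)) ha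
        obtain ⟨u, rfl⟩ := ih b ((le_pr_right _ b).trans_lt (lt_pr (by simp) _)) hb
        exact ⟨.add t u, rfl⟩
      · obtain ⟨t, rfl⟩ := ih a ((le_pr_left a b).trans_lt (lt_pr (by simp) _)) ha
        obtain ⟨u, rfl⟩ := ih b ((le_pr_right _ b).trans_lt (lt_pr (by simp) _)) hb
        exact ⟨.mul t u, rfl⟩
  · rintro ⟨t, rfl⟩
    induction t with
    | var i => exact (ind_iff (finitary_tmStep n) _).2 (.inl ⟨i, i.2, rfl⟩)
    | zero => exact (ind_iff (finitary_tmStep n) _).2 (.inr (.inl rfl))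
    | succ t ih => exact (ind_iff (finitary_tmStep n) _).2 (.inr (.inr (.inl ⟨_, ih, rfl⟩)))
    | add t u iht ihu =>
      exact (ind_iff (finitary_tmStep n) _).2 (.inr (.inr (.inr ⟨_, _, iht, ihu, .inl rfl⟩)))
    | mul t u iht ihu =>
      exact (ind_iff (finitary_tmStep n) _).2 (.inr (.inr (.inr ⟨_, _, iht, ihu, .inr rfl⟩)))

@[simp] theorem sat_isTm (S : Set ℕ) {n : ℕ} (k x : Tm n) (e : Fin n → ℕ) :
    (isTm k x).Sat S e ↔ IsTm (k.val e) (x.val e) := by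
  rw [← ind_tmStep, ← exists_mem_iff_ind (enc := id) Function.injective_id]
  simp [isTm, tmF, tmStep]

@[simp] theorem sat_isCT (S : Set ℕ) {n : ℕ} (x : Tm n) (e : Fin n → ℕ) :
    (isCT x).Sat S e ↔ IsTm 0 (x.val e) := by
  simp [isCT]

/-- Pairs as numbers. -/
def encPair (p : ℕ × ℕ) : ℕ := pr p.1 p.2

theorem encPair_injective : Function.Injective encPair := fun _ _ h =>
  Prod.ext (pr_inj.1 h).1 (pr_inj.1 h).2

/-- One step in building (the code of) a formula, as in `fmF`; the first component of the pair bounds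
the free variables. -/
def fmStep (P : ℕ × ℕ → Prop) (p : ℕ × ℕ) : Prop :=
  (∃ a b, IsTm p.1 a ∧ IsTm p.1 b ∧ p.2 = pr 6 (pr a b)) ∨ (∃ a, IsTm p.1 a ∧ p.2 = pr 7 a) ∨
    (∃ a, P (p.1, a) ∧ p.2 = pr 8 a) ∨
    (∃ a b, P (p.1, a) ∧ P (p.1, b) ∧ (p.2 = pr 9 (pr a b) ∨ p.2 = pr 10 (pr a b))) ∨
    ∃ a, P (p.1 + 1, a) ∧ (p.2 = pr 11 a ∨ p.2 = pr 12 a)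

theorem finitary_fmStep (p : ℕ × ℕ) : Finitary fun P => fmStep P p := by
  unfold fmStep
  repeat' first
    | exact .const _ | exact .atom _ | apply Finitary.or | apply Finitary.and
    | refine Finitary.exists fun _ => ?_

/-- `x` is the code of a formula with free variables below `n`. -/
def IsFm (n x : ℕ) : Prop := ∃ φ : Fm n, x = φ.code

theorem ind_fmStep (n x : ℕ) : Ind fmStep (n, x) ↔ IsFm n x := by
  constructor
  · induction x using Nat.strong_induction_on generalizing n with
    | _ x ih =>
      rw [ind_iff finitary_fmStep, fmStep]
      dsimp only
      rintro (⟨a, b, ⟨t, rfl⟩, ⟨u, rfl⟩, h⟩ | ⟨a, ⟨t, rfl⟩, h⟩ | ⟨a, ha, h⟩ | ⟨a, b, ha, hb, h | h⟩ |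
        ⟨a, ha, h | h⟩) <;> subst h
      · exact ⟨.eq t u, rfl⟩
      · exact ⟨.tr t, rfl⟩
      · obtain ⟨φ, rfl⟩ := ih a (lt_pr (by simp) a) _ ha
        exact ⟨.neg φ, rfl⟩
      · obtain ⟨φ, rfl⟩ := ih a ((le_pr_left a b).trans_lt (lt_pr (by simp) _)) _ ha
        obtain ⟨ψ, rfl⟩ := ih b ((le_pr_right _ b).trans_lt (lt_pr (by simp) _)) _ hb
        exact ⟨.or φ ψ, rfl⟩
      · obtain ⟨φ, rfl⟩ := ih a ((le_pr_left a b).trans_lt (lt_pr (by simp) _)) _ ha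
        obtain ⟨ψ, rfl⟩ := ih b ((le_pr_right _ b).trans_lt (lt_pr (by simp) _)) _ hb
        exact ⟨.and φ ψ, rfl⟩
      · obtain ⟨φ, rfl⟩ := ih a (lt_pr (by simp) a) _ ha
        exact ⟨.all φ, rfl⟩
      · obtain ⟨φ, rfl⟩ := ih a (lt_pr (by simp) a) _ ha
        exact ⟨.ex φ, rfl⟩
  · rintro ⟨φ, rfl⟩
    induction φ with
    | eq t u => exact (ind_iff finitary_fmStep _).2 (.inl ⟨_, _, ⟨t, rfl⟩, ⟨u, rfl⟩, rfl⟩)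
    | tr t => exact (ind_iff finitary_fmStep _).2 (.inr (.inl ⟨_, ⟨t, rfl⟩, rfl⟩))
    | neg φ ih => exact (ind_iff finitary_fmStep _).2 (.inr (.inr (.inl ⟨_, ih, rfl⟩)))
    | or φ ψ ih ih' =>
      exact (ind_iff finitary_fmStep _).2 (.inr (.inr (.inr (.inl ⟨_, _, ih, ih', .inl rfl⟩))))
    | and φ ψ ih ih' =>
      exact (ind_iff finitary_fmStep _).2 (.inr (.inr (.inr (.inl ⟨_, _, ih, ih', .inr rfl⟩))))
    | all φ ih =>
      exact (ind_iff finitary_fmStep _).2 (.inr (.inr (.inr (.inr ⟨_, ih, .inl rfl⟩))))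
    | ex φ ih =>
      exact (ind_iff finitary_fmStep _).2 (.inr (.inr (.inr (.inr ⟨_, ih, .inr rfl⟩))))

@[simp] theorem sat_isFm (S : Set ℕ) {n : ℕ} (k x : Tm n) (e : Fin n → ℕ) :
    (isFm k x).Sat S e ↔ IsFm (k.val e) (x.val e) := by
  rw [← ind_fmStep, ← exists_mem_iff_ind encPair_injective]
  simp [isFm, fmF, fmStep, encPair]

@[simp] theorem sat_isSent (S : Set ℕ) {n : ℕ} (x : Tm n) (e : Fin n → ℕ) :
    (isSent x).Sat S e ↔ IsSent (x.val e) := by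
  simp only [isSent, sat_isFm, Tm.val_nm]
  exact Iff.rfl

/-- One step in evaluating a closed term: the pair consists of the code of the term and its value. -/
def valStep (P : ℕ × ℕ → Prop) (p : ℕ × ℕ) : Prop :=
  (p.1 = pr 2 0 ∧ p.2 = 0) ∨ (∃ a b, P (a, b) ∧ p.1 = pr 3 a ∧ p.2 = b + 1) ∨
    ∃ a b c d, P (a, b) ∧ P (c, d) ∧
      ((p.1 = pr 4 (pr a c) ∧ p.2 = b + d) ∨ (p.1 = pr 5 (pr a c) ∧ p.2 = b * d))

theorem finitary_valStep (p : ℕ × ℕ) : Finitary fun P => valStep P p := by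
  unfold valStep
  repeat' first
    | exact .const _ | exact .atom _ | apply Finitary.or | apply Finitary.and
    | refine Finitary.exists fun _ => ?_

/-- `y` is the value of the closed term coded by `x`. -/
def IsVal (x y : ℕ) : Prop := ∃ t : CTm, x = t.code ∧ y = ev t

theorem ind_valStep (x y : ℕ) : Ind valStep (x, y) ↔ IsVal x y := by
  constructor
  · induction x using Nat.strong_induction_on generalizing y with
    | _ x ih =>
      rw [ind_iff finitary_valStep, valStep]
      dsimp only
      rintro (⟨h, h'⟩ | ⟨a, b, hab, h, h'⟩ | ⟨a, b, c, d, hab, hcd, ⟨h, h'⟩ | ⟨h, h'⟩⟩) <;>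
        subst h h'
      · exact ⟨.zero, rfl, rfl⟩
      · obtain ⟨t, rfl, rfl⟩ := ih a (lt_pr (by simp) a) _ hab
        exact ⟨.succ t, rfl, rfl⟩
      · obtain ⟨t, rfl, rfl⟩ := ih a ((le_pr_left a c).trans_lt (lt_pr (by simp) _)) _ hab
        obtain ⟨u, rfl, rfl⟩ := ih c ((le_pr_right _ c).trans_lt (lt_pr (by simp) _)) _ hcd
        exact ⟨.add t u, rfl, rfl⟩
      · obtain ⟨t, rfl, rfl⟩ := ih a ((le_pr_left a c).trans_lt (lt_pr (by simp) _)) _ hab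
        obtain ⟨u, rfl, rfl⟩ := ih c ((le_pr_right _ c).trans_lt (lt_pr (by simp) _)) _ hcd
        exact ⟨.mul t u, rfl, rfl⟩
  · rintro ⟨t, rfl, rfl⟩
    induction t with
    | var i => exact i.elim0
    | zero => exact (ind_iff finitary_valStep _).2 (.inl ⟨rfl, rfl⟩)
    | succ t ih => exact (ind_iff finitary_valStep _).2 (.inr (.inl ⟨_, _, ih, rfl, rfl⟩))
    | add t u iht ihu =>
      exact (ind_iff finitary_valStep _).2
        (.inr (.inr ⟨_, _, _, _, iht, ihu, .inl ⟨rfl, rfl⟩⟩))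
    | mul t u iht ihu =>
      exact (ind_iff finitary_valStep _).2
        (.inr (.inr ⟨_, _, _, _, iht, ihu, .inr ⟨rfl, rfl⟩⟩))

@[simp] theorem sat_isVal (S : Set ℕ) {n : ℕ} (x y : Tm n) (e : Fin n → ℕ) :
    (isVal x y).Sat S e ↔ IsVal (x.val e) (y.val e) := by
  rw [← ind_valStep, ← exists_mem_iff_ind encPair_injective]
  simp [isVal, valF, valStep, encPair]

/-- One step in building a numeral: the pair consists of a number and the code of its numeral. -/
def numStep (P : ℕ × ℕ → Prop) (p : ℕ × ℕ) : Prop :=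
  (p.1 = 0 ∧ p.2 = pr 2 0) ∨ ∃ a b, P (a, b) ∧ p.1 = a + 1 ∧ p.2 = pr 3 b

theorem finitary_numStep (p : ℕ × ℕ) : Finitary fun P => numStep P p := by
  unfold numStep
  repeat' first
    | exact .const _ | exact .atom _ | apply Finitary.or | apply Finitary.and
    | refine Finitary.exists fun _ => ?_

theorem ind_numStep (x y : ℕ) : Ind numStep (x, y) ↔ y = (nm x : CTm).code := by
  induction x generalizing y with
  | zero =>
    rw [ind_iff finitary_numStep]
    simp [numStep, nm, Tm.code]
  | succ x ih =>
    rw [ind_iff finitary_numStep]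
    simp only [numStep, nm, Tm.code]
    constructor
    · rintro (⟨h, _⟩ | ⟨a, b, hab, h, h'⟩)
      · exact absurd h (Nat.succ_ne_zero x)
      · obtain rfl := Nat.succ.inj h
        rw [h', (ih b).1 hab]
    · rintro rfl
      exact .inr ⟨x, _, (ih _).2 rfl, rfl, rfl⟩

@[simp] theorem sat_isNum (S : Set ℕ) {n : ℕ} (x y : Tm n) (e : Fin n → ℕ) :
    (isNum x y).Sat S e ↔ y.val e = (nm (x.val e) : CTm).code := by
  rw [← ind_numStep, ← exists_mem_iff_ind encPair_injective]
  simp [isNum, numF, numStep, encPair]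

/-! ### Substitution on codes -/

/-- One step in replacing variables: the pair consists of a code before and after the replacement, and
`C i w` says that the variable `i` may be replaced by `w`. -/
def replStep (C : ℕ → ℕ → Prop) (P : ℕ × ℕ → Prop) (p : ℕ × ℕ) : Prop :=
  (∃ i, p.1 = pr 1 i ∧ C i p.2) ∨ (p.1 = pr 2 0 ∧ p.2 = pr 2 0) ∨
    (∃ a b, P (a, b) ∧ ((p.1 = pr 3 a ∧ p.2 = pr 3 b) ∨ (p.1 = pr 7 a ∧ p.2 = pr 7 b) ∨
      (p.1 = pr 8 a ∧ p.2 = pr 8 b) ∨ (p.1 = pr 11 a ∧ p.2 = pr 11 b) ∨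
      (p.1 = pr 12 a ∧ p.2 = pr 12 b))) ∨
    ∃ a b c d, P (a, b) ∧ P (c, d) ∧
      ((p.1 = pr 4 (pr a c) ∧ p.2 = pr 4 (pr b d)) ∨ (p.1 = pr 5 (pr a c) ∧ p.2 = pr 5 (pr b d)) ∨
      (p.1 = pr 6 (pr a c) ∧ p.2 = pr 6 (pr b d)) ∨ (p.1 = pr 9 (pr a c) ∧ p.2 = pr 9 (pr b d)) ∨
      (p.1 = pr 10 (pr a c) ∧ p.2 = pr 10 (pr b d)))

theorem finitary_replStep (C : ℕ → ℕ → Prop) (p : ℕ × ℕ) : Finitary fun P => replStep C P p := by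
  unfold replStep
  repeat' first
    | exact .const _ | exact .atom _ | apply Finitary.or | apply Finitary.and
    | refine Finitary.exists fun _ => ?_

/-- `z` results from `x` by replacing the variables, where `C i w` says that the variable `i` may be
replaced by `w`. -/
def Repl (C : ℕ → ℕ → Prop) (x z : ℕ) : Prop := Ind (replStep C) (x, z)

theorem repl_iff {C : ℕ → ℕ → Prop} {x z : ℕ} :
    Repl C x z ↔ replStep C (fun p => Repl C p.1 p.2) (x, z) :=
  ind_iff (finitary_replStep C) _

theorem repl_var {C : ℕ → ℕ → Prop} {i z : ℕ} : Repl C (pr 1 i) z ↔ C i z := by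
  rw [repl_iff]; simp [replStep, pr_inj]

theorem repl_zero {C : ℕ → ℕ → Prop} {z : ℕ} : Repl C (pr 2 0) z ↔ z = pr 2 0 := by
  rw [repl_iff]; simp [replStep, pr_inj]

theorem repl_unary {C : ℕ → ℕ → Prop} {k a z : ℕ}
    (hk : k = 3 ∨ k = 7 ∨ k = 8 ∨ k = 11 ∨ k = 12) :
    Repl C (pr k a) z ↔ ∃ b, Repl C a b ∧ z = pr k b := by
  rw [repl_iff]
  rcases hk with rfl | rfl | rfl | rfl | rfl <;> simp [replStep, pr_inj]

theorem repl_binary {C : ℕ → ℕ → Prop} {k a c z : ℕ}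
    (hk : k = 4 ∨ k = 5 ∨ k = 6 ∨ k = 9 ∨ k = 10) :
    Repl C (pr k (pr a c)) z ↔ ∃ b d, Repl C a b ∧ Repl C c d ∧ z = pr k (pr b d) := by
  rw [repl_iff]
  rcases hk with rfl | rfl | rfl | rfl | rfl <;>
    simp [replStep, pr_inj]

theorem Tm.code_lift {n : ℕ} (t : Tm n) : t.lift.code = t.code := by
  unfold Tm.lift
  induction t <;> simp_all [Tm.subst, Tm.code]

theorem repl_tm_code {C : ℕ → ℕ → Prop} {n m : ℕ} {σ : Fin n → Tm m}
    (h : ∀ (i : Fin n) (w : ℕ), C i w ↔ w = (σ i).code) (t : Tm n) (z : ℕ) :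
    Repl C t.code z ↔ z = (t.subst σ).code := by
  induction t generalizing z with
  | var i => exact repl_var.trans (h i z)
  | zero => exact repl_zero
  | succ t ih => simp [Tm.code, Tm.subst, repl_unary, ih]
  | add t u iht ihu | mul t u iht ihu => simp [Tm.code, Tm.subst, repl_binary, iht, ihu]

/-- If the clause `C` describes `σ` on the free variables and shifts the variables that get bound from
`n + k` to `m + k`, then replacing by `C` on codes is substitution of `σ`. -/
theorem repl_fm_code {C : ℕ → ℕ → Prop} {n m : ℕ} {σ : Fin n → Tm m}
    (h : ∀ (i : Fin n) (w : ℕ), C i w ↔ w = (σ i).code)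
    (h' : ∀ k w, C (n + k) w ↔ w = pr 1 (m + k)) (φ : Fm n) (z : ℕ) :
    Repl C φ.code z ↔ z = (φ.subst σ).code := by
  have hlift : ∀ {n m : ℕ} {σ : Fin n → Tm m}, (∀ (i : Fin n) (w : ℕ), C i w ↔ w = (σ i).code) →
      (∀ k w, C (n + k) w ↔ w = pr 1 (m + k)) →
      ∀ (i : Fin (n + 1)) (w : ℕ), C i w ↔ w = (liftSubst σ i).code := by
    intro n m σ h h' i w
    refine Fin.lastCases ?_ (fun i => ?_) i
    · simpa [liftSubst, Tm.code] using h' 0 w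
    · simpa [liftSubst, Tm.code_lift] using h i w
  induction φ generalizing m z with
  | eq t u => simp [Fm.code, Fm.subst, repl_binary, repl_tm_code h]
  | tr t => simp [Fm.code, Fm.subst, repl_unary, repl_tm_code h]
  | neg φ ih => simp [Fm.code, Fm.subst, repl_unary, ih h h']
  | or φ ψ ih ih' | and φ ψ ih ih' =>
    simp [Fm.code, Fm.subst, repl_binary, ih h h', ih' h h']
  | @all n φ ih | @ex n φ ih =>
    have := ih (hlift h h') fun k w => by
      have := h' (k + 1) w
      rwa [show n + (k + 1) = n + 1 + k by omega, show m + (k + 1) = m + 1 + k by omega] at this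
    simp [Fm.code, Fm.subst, repl_unary, this]

theorem sat_replF (S : Set ℕ) (cl : Fm 4) (k t x z : ℕ) :
    (replF cl).Sat S ![k, t, x, z] ↔ Repl (fun i w => cl.Sat S ![k, t, i, w]) x z := by
  rw [Repl, ← exists_mem_iff_ind encPair_injective]
  simp [replF, replStep, encPair]

/-- The relation defined by `instCl`. -/
def InstCl (k t i w : ℕ) : Prop :=
  (i < k ∧ w = pr 1 i) ∨ (i = k ∧ w = t) ∨ ∃ d, i = k + d + 1 ∧ w = pr 1 (k + d)

@[simp] theorem sat_isInst (S : Set ℕ) {n : ℕ} (k t x z : Tm n) (e : Fin n → ℕ) :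
    (isInst k t x z).Sat S e ↔ Repl (InstCl (k.val e) (t.val e)) (x.val e) (z.val e) := by
  rw [isInst, sat_subst_four, sat_replF]
  have : (fun i w => instCl.Sat S ![k.val e, t.val e, i, w]) = InstCl (k.val e) (t.val e) := by
    funext i w
    simp [instCl, InstCl, Nat.add_assoc]
  rw [this]

theorem repl_instCl {k : ℕ} (φ : Fm (k + 1)) (t : Tm k) (z : ℕ) :
    Repl (InstCl k t.code) φ.code z ↔ z = (φ.inst t).code := by
  refine repl_fm_code (fun i w => ?_) (fun j w => ?_) φ z
  · refine Fin.lastCases ?_ (fun i => ?_) i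
    · simp only [InstCl, Fin.val_last, Fin.snoc_last]
      exact ⟨by rintro (⟨h, -⟩ | ⟨-, h⟩ | ⟨d, h, -⟩) <;> omega,
        fun h => .inr (.inl ⟨trivial, h⟩)⟩
    · have := i.2
      simp only [InstCl, Fin.val_castSucc, Fin.snoc_castSucc]
      exact ⟨by rintro (⟨-, h⟩ | ⟨h, -⟩ | ⟨d, h, -⟩) <;> first | omega | exact h,
        fun h => .inl ⟨this, h⟩⟩
  · simp only [InstCl]
    constructor
    · rintro (⟨h, -⟩ | ⟨h, -⟩ | ⟨d, h, h'⟩)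
      · omega
      · omega
      · obtain rfl : j = d := by omega
        exact h'
    · exact fun h => .inr (.inr ⟨j, by omega, h⟩)

/-- The relation defined by `liftCl`. -/
def LiftCl (k i w : ℕ) : Prop :=
  (i < k ∧ w = pr 1 i) ∨ ∃ d, i = k + d ∧ w = pr 1 (i + 1)

@[simp] theorem sat_isLift (S : Set ℕ) {n : ℕ} (k x z : Tm n) (e : Fin n → ℕ) :
    (isLift k x z).Sat S e ↔ Repl (LiftCl (k.val e)) (x.val e) (z.val e) := by
  rw [isLift, sat_subst_four, sat_replF]
  have : (fun i w => liftCl.Sat S ![k.val e, Tm.val e .zero, i, w]) = LiftCl (k.val e) := by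
    funext i w
    simp [liftCl, LiftCl]
  rw [this]

theorem repl_liftCl {k : ℕ} (φ : Fm k) (z : ℕ) :
    Repl (LiftCl k) φ.code z ↔ z = φ.lift.code := by
  refine repl_fm_code (fun i w => ?_) (fun j w => ?_) φ z
  · have := i.2
    simp only [LiftCl]
    exact ⟨by rintro (⟨-, h⟩ | ⟨d, h, -⟩) <;> [exact h; omega], fun h => .inl ⟨this, h⟩⟩
  · simp only [LiftCl, show k + 1 + j = k + j + 1 by omega]
    exact ⟨by rintro (⟨h, -⟩ | ⟨d, -, h⟩) <;> omega, fun h => .inr ⟨j, rfl, h⟩⟩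

/-- The relation defined by `succCl`. -/
def SuccCl (k i w : ℕ) : Prop :=
  (i = k ∧ w = pr 3 (pr 1 k)) ∨ (¬ i = k ∧ w = pr 1 i)

@[simp] theorem sat_isInstSucc (S : Set ℕ) {n : ℕ} (k x z : Tm n) (e : Fin n → ℕ) :
    (isInstSucc k x z).Sat S e ↔ Repl (SuccCl (k.val e)) (x.val e) (z.val e) := by
  rw [isInstSucc, sat_subst_four, sat_replF]
  have : (fun i w => succCl.Sat S ![k.val e, Tm.val e .zero, i, w]) = SuccCl (k.val e) := by
    funext i w
    simp [succCl, SuccCl]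
  rw [this]

theorem repl_succCl {k : ℕ} (φ : Fm (k + 1)) (z : ℕ) :
    Repl (SuccCl k) φ.code z ↔ z = φ.instSucc.code := by
  refine repl_fm_code (fun i w => ?_) (fun j w => ?_) φ z
  · refine Fin.lastCases ?_ (fun i => ?_) i
    · simp [SuccCl, Tm.code]
    · simp [SuccCl, Tm.code, i.2.ne]
  · simp [SuccCl, show k + 1 + j ≠ k by omega]

/-! ### Provability -/

theorem sat_logAxF (S : Set ℕ) (n y : ℕ) :
    logAxF.Sat S ![n, y] ↔ ∃ φ : Fm n, y = φ.code ∧ LogAx n φ := by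
  simp only [logAxF, dEq, dNeg, dOr, dAnd, dAll, dEx, dImp,
    sat_or, sat_ex, sat_and, sat_eq, sat_isFm, sat_isTm, sat_isInst, snoc_vecCons, snoc_vecEmpty,
    val_var, val_succ, val_dPr, Tm.val_nm, Matrix.cons_val]
  constructor
  · rintro (⟨_, _, _, ⟨a, rfl⟩, ⟨b, rfl⟩, ⟨c, rfl⟩,
      rfl | rfl | rfl | rfl | rfl | rfl | rfl | rfl | rfl⟩ |
      ⟨_, _, _, ⟨a, rfl⟩, ⟨t, rfl⟩, h, h'⟩ | ⟨_, ⟨t, rfl⟩, rfl⟩ |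
      ⟨_, _, _, _, _, ⟨a, rfl⟩, ⟨t, rfl⟩, ⟨u, rfl⟩, ht, hu, rfl⟩)
    · exact ⟨_, rfl, .k a b⟩
    · exact ⟨_, rfl, .s a b c⟩
    · exact ⟨_, rfl, .contra a b⟩
    · exact ⟨_, rfl, .andLeft a b⟩
    · exact ⟨_, rfl, .andRight a b⟩
    · exact ⟨_, rfl, .andIntro a b⟩
    · exact ⟨_, rfl, .orLeft a b⟩
    · exact ⟨_, rfl, .orRight a b⟩
    · exact ⟨_, rfl, .orElim a b c⟩
    · rw [repl_instCl] at h
      subst h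
      rcases h' with rfl | rfl
      · exact ⟨_, rfl, .allElim a t⟩
      · exact ⟨_, rfl, .exIntro a t⟩
    · exact ⟨_, rfl, .eqRefl t⟩
    · rw [repl_instCl] at ht hu
      subst ht hu
      exact ⟨_, rfl, .eqSubst a t u⟩
  · have hF : ∀ {m} (φ : Fm m), IsFm m φ.code := fun φ => ⟨φ, rfl⟩
    have hT : ∀ {m} (t : Tm m), IsTm m t.code := fun t => ⟨t, rfl⟩
    have hI : ∀ {m} (φ : Fm (m + 1)) t, Repl (InstCl m t.code) φ.code (φ.inst t).code :=
      fun φ t => (repl_instCl φ t _).2 rfl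
    rintro ⟨φ, rfl, h⟩
    cases h with
    | k a b => exact .inl ⟨_, _, _, hF a, hF b, hF a, .inl rfl⟩
    | s a b c => exact .inl ⟨_, _, _, hF a, hF b, hF c, .inr (.inl rfl)⟩
    | contra a b => exact .inl ⟨_, _, _, hF a, hF b, hF a, .inr (.inr (.inl rfl))⟩
    | andLeft a b => exact .inl ⟨_, _, _, hF a, hF b, hF a, .inr (.inr (.inr (.inl rfl)))⟩
    | andRight a b => exact .inl ⟨_, _, _, hF a, hF b, hF a, .inr (.inr (.inr (.inr (.inl rfl))))⟩
    | andIntro a b =>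
      exact .inl ⟨_, _, _, hF a, hF b, hF a, .inr (.inr (.inr (.inr (.inr (.inl rfl)))))⟩
    | orLeft a b =>
      exact .inl ⟨_, _, _, hF a, hF b, hF a, .inr (.inr (.inr (.inr (.inr (.inr (.inl rfl))))))⟩
    | orRight a b =>
      exact .inl ⟨_, _, _, hF a, hF b, hF a,
        .inr (.inr (.inr (.inr (.inr (.inr (.inr (.inl rfl)))))))⟩
    | orElim a b c =>
      exact .inl ⟨_, _, _, hF a, hF b, hF c,
        .inr (.inr (.inr (.inr (.inr (.inr (.inr (.inr rfl)))))))⟩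
    | allElim a t => exact .inr (.inl ⟨_, _, _, hF a, hT t, hI a t, .inl rfl⟩)
    | exIntro a t => exact .inr (.inl ⟨_, _, _, hF a, hT t, hI a t, .inr rfl⟩)
    | eqRefl t => exact .inr (.inr (.inl ⟨_, hT t, rfl⟩))
    | eqSubst a t u =>
      exact .inr (.inr (.inr ⟨_, _, _, _, _, hF a, hT t, hT u, hI a t, hI a u, rfl⟩))

theorem sat_arithAxF (S : Set ℕ) (n y : ℕ) :
    arithAxF.Sat S ![n, y] ↔ ∃ φ : Fm n, y = φ.code ∧ ArithAx n φ := by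
  simp only [arithAxF, dZero, dSucc, dAdd, dMul, dEq, dNeg, dOr, dAnd, dAll, dImp,
    sat_or, sat_ex, sat_and, sat_eq, sat_isFm, sat_isTm, sat_isInst, sat_isInstSucc, snoc_vecCons,
    snoc_vecEmpty, val_var, val_succ, val_dPr, Tm.val_nm, Matrix.cons_val]
  constructor
  · rintro (⟨_, _, ⟨t, rfl⟩, ⟨u, rfl⟩, rfl | rfl | rfl | rfl | rfl | rfl⟩ |
      ⟨_, _, _, ⟨a, rfl⟩, h, h', rfl⟩)
    · exact ⟨_, rfl, .succNeZero t⟩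
    · exact ⟨_, rfl, .succInj t u⟩
    · exact ⟨_, rfl, .addZero t⟩
    · exact ⟨_, rfl, .addSucc t u⟩
    · exact ⟨_, rfl, .mulZero t⟩
    · exact ⟨_, rfl, .mulSucc t u⟩
    · have hz : pr 2 0 = (Tm.zero : Tm n).code := rfl
      rw [hz, repl_instCl] at h
      rw [repl_succCl] at h'
      subst h h'
      exact ⟨_, rfl, .ind a⟩
  · have hT : ∀ t : Tm n, IsTm n t.code := fun t => ⟨t, rfl⟩
    rintro ⟨φ, rfl, h⟩
    cases h with
    | succNeZero t => exact .inl ⟨_, _, hT t, hT t, .inl rfl⟩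
    | succInj t u => exact .inl ⟨_, _, hT t, hT u, .inr (.inl rfl)⟩
    | addZero t => exact .inl ⟨_, _, hT t, hT t, .inr (.inr (.inl rfl))⟩
    | addSucc t u => exact .inl ⟨_, _, hT t, hT u, .inr (.inr (.inr (.inl rfl)))⟩
    | mulZero t => exact .inl ⟨_, _, hT t, hT t, .inr (.inr (.inr (.inr (.inl rfl))))⟩
    | mulSucc t u => exact .inl ⟨_, _, hT t, hT u, .inr (.inr (.inr (.inr (.inr rfl))))⟩
    | ind a =>
      exact .inr ⟨_, _, _, ⟨a, rfl⟩, (repl_instCl a .zero _).2 rfl, (repl_succCl a _).2 rfl, rfl⟩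

/-- Triples as numbers. -/
def encTriple (p : ℕ × ℕ × ℕ) : ℕ := pr p.1 (pr p.2.1 p.2.2)

theorem encTriple_injective : Function.Injective encTriple := fun p q h => by
  obtain ⟨h1, h2⟩ := pr_inj.1 h
  obtain ⟨h2, h3⟩ := pr_inj.1 h2
  exact Prod.ext h1 (Prod.ext h2 h3)

/-- One step of a derivation, as in `provF`: the triple consists of the rank of an entry, a bound for
the free variables, and the code of the formula. -/
def provStep (P : ℕ × ℕ × ℕ → Prop) (p : ℕ × ℕ × ℕ) : Prop :=
  (∃ φ : Fm p.2.1, p.2.2 = φ.code ∧ LogAx p.2.1 φ) ∨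
  (∃ φ : Fm p.2.1, p.2.2 = φ.code ∧ ArithAx p.2.1 φ) ∨
  (∃ r r' x, r < p.1 ∧ r' < p.1 ∧ P (r, p.2.1, pr 9 (pr (pr 8 x) p.2.2)) ∧ P (r', p.2.1, x)) ∨
  ∃ r a b a', r < p.1 ∧ IsFm p.2.1 a ∧ Repl (LiftCl p.2.1) a a' ∧
    ((P (r, p.2.1 + 1, pr 9 (pr (pr 8 a') b)) ∧ p.2.2 = pr 9 (pr (pr 8 a) (pr 11 b))) ∨
      (P (r, p.2.1 + 1, pr 9 (pr (pr 8 b) a')) ∧ p.2.2 = pr 9 (pr (pr 8 (pr 12 b)) a)))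

theorem finitary_provStep (p : ℕ × ℕ × ℕ) : Finitary fun P => provStep P p := by
  unfold provStep
  repeat' first
    | exact .const _ | exact .atom _ | apply Finitary.or | apply Finitary.and
    | refine Finitary.exists fun _ => ?_

theorem code_imp_inv {n a b : ℕ} {φ : Fm n} (h : φ.code = pr 9 (pr (pr 8 a) b)) :
    ∃ ψ χ : Fm n, a = ψ.code ∧ b = χ.code ∧ φ = (ψ ⟹ χ) := by
  cases φ <;> simp [Fm.code, pr_inj] at h
  rename_i ψ χ
  obtain ⟨h, rfl⟩ := h
  cases ψ <;> simp [Fm.code, pr_inj] at h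
  exact ⟨_, _, h.symm, rfl, rfl⟩

/-- The rank of an entry of a derivation bounds its height, so induction on the rank recovers a
derivation from a finite closed set of entries. -/
theorem ind_provStep (n y : ℕ) :
    (∃ r, Ind provStep (r, n, y)) ↔ ∃ φ : Fm n, y = φ.code ∧ Prov n φ := by
  constructor
  · rintro ⟨r, h⟩
    induction r using Nat.strong_induction_on generalizing n y with
    | _ r ih =>
      rw [ind_iff finitary_provStep, provStep] at h
      dsimp only at h
      rcases h with ⟨φ, h, hφ⟩ | ⟨φ, h, hφ⟩ | ⟨r1, r2, x, h1, h2, h3, h4⟩ |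
        ⟨r', _, b, _, hr, ⟨a, rfl⟩, ha, ⟨h, rfl⟩ | ⟨h, rfl⟩⟩
      · exact ⟨φ, h, .log hφ⟩
      · exact ⟨φ, h, .arith hφ⟩
      · obtain ⟨φ, e, hφ⟩ := ih r1 h1 _ _ h3
        obtain ⟨ψ, rfl, hψ⟩ := ih r2 h2 _ _ h4
        obtain ⟨ψ', χ, hx, rfl, rfl⟩ := code_imp_inv e.symm
        obtain rfl := Fm.code_injective hx
        exact ⟨χ, rfl, .mp hφ hψ⟩
      · obtain ⟨φ, e, hφ⟩ := ih r' hr _ _ h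
        obtain ⟨ψ, χ, rfl, rfl, rfl⟩ := code_imp_inv e.symm
        rw [repl_liftCl, Fm.code_inj] at ha
        subst ha
        exact ⟨a ⟹ .all χ, rfl, .allRule hφ⟩
      · obtain ⟨φ, e, hφ⟩ := ih r' hr _ _ h
        obtain ⟨ψ, χ, rfl, rfl, rfl⟩ := code_imp_inv e.symm
        rw [repl_liftCl, Fm.code_inj] at ha
        subst ha
        exact ⟨.ex ψ ⟹ a, rfl, .exRule hφ⟩
  · rintro ⟨φ, rfl, h⟩
    induction h with
    | log h => exact ⟨0, (ind_iff finitary_provStep _).2 (.inl ⟨_, rfl, h⟩)⟩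
    | arith h => exact ⟨0, (ind_iff finitary_provStep _).2 (.inr (.inl ⟨_, rfl, h⟩))⟩
    | mp _ _ ih1 ih2 =>
      obtain ⟨r1, h1⟩ := ih1
      obtain ⟨r2, h2⟩ := ih2
      -- Both premises need smaller ranks than the conclusion.
      exact ⟨max r1 r2 + 1, (ind_iff finitary_provStep _).2 (.inr (.inr (.inl
        ⟨r1, r2, _, Nat.lt_succ_of_le (le_max_left _ _), Nat.lt_succ_of_le (le_max_right _ _),
          h1, h2⟩)))⟩
    | allRule _ ih =>
      obtain ⟨r, h⟩ := ih
      exact ⟨r + 1, (ind_iff finitary_provStep _).2 (.inr (.inr (.inr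
        ⟨r, _, _, _, Nat.lt_succ_self r, ⟨_, rfl⟩, (repl_liftCl _ _).2 rfl, .inl ⟨h, rfl⟩⟩)))⟩
    | exRule _ ih =>
      obtain ⟨r, h⟩ := ih
      exact ⟨r + 1, (ind_iff finitary_provStep _).2 (.inr (.inr (.inr
        ⟨r, _, _, _, Nat.lt_succ_self r, ⟨_, rfl⟩, (repl_liftCl _ _).2 rfl, .inr ⟨h, rfl⟩⟩)))⟩

@[simp] theorem sat_isProv (S : Set ℕ) {n : ℕ} (x : Tm n) (e : Fin n → ℕ) :
    (isProv x).Sat S e ↔ ∃ φ : Sentence, x.val e = φ.code ∧ Prov 0 φ := by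
  rw [← ind_provStep]
  simp only [← exists_mem_iff_ind encTriple_injective]
  rw [exists_comm]
  simp [isProv, provF, provStep, encTriple, sat_logAxF, sat_arithAxF]

/-! ### Derivations in PAT -/

namespace Prov
variable {n : ℕ} {a b c : Fm n}

theorem id (a : Fm n) : Prov n (a ⟹ a) :=
  .mp (.mp (.log (.s a (a ⟹ a) a)) (.log (.k a (a ⟹ a)))) (.log (.k a a))

theorem weaken (h : Prov n b) : Prov n (a ⟹ b) := .mp (.log (.k b a)) h

theorem trans (h : Prov n (a ⟹ b)) (h' : Prov n (b ⟹ c)) : Prov n (a ⟹ c) :=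
  .mp (.mp (.log (.s a b c)) (weaken h')) h

theorem dne (a : Fm n) : Prov n (.neg (.neg a) ⟹ a) :=
  .mp (.mp (.log (.s _ _ _))
    (trans (trans (.log (.k _ (.neg (.neg (.neg (.neg a)))))) (.log (.contra _ _)))
      (.log (.contra _ _)))) (id _)

theorem dni (a : Fm n) : Prov n (a ⟹ .neg (.neg a)) := .mp (.log (.contra _ _)) (dne _)

theorem contrapose (h : Prov n (a ⟹ b)) : Prov n (.neg b ⟹ .neg a) :=
  .mp (.log (.contra _ _)) (trans (trans (dne a) h) (dni b))

theorem contrapose' (h : Prov n (a ⟹ .neg b)) : Prov n (b ⟹ .neg a) :=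
  trans (dni b) (contrapose h)

theorem neg_or_of_and_neg (a b : Fm n) : Prov n (.neg a ⋏ .neg b ⟹ .neg (a ⋎ b)) :=
  contrapose' (.mp (.mp (.log (.orElim _ _ _)) (contrapose' (.log (.andLeft _ _))))
    (contrapose' (.log (.andRight _ _))))

theorem neg_ex_of_all_neg (a : Fm (n + 1)) : Prov n (.all (.neg a) ⟹ .neg (.ex a)) := by
  refine contrapose' (.exRule ?_)
  have h : Prov (n + 1) ((Fm.all (.neg a)).lift ⟹ .neg a) := by
    have h1 := Prov.log (.allElim ((Fm.neg a).subst
      (liftSubst fun i : Fin n => Tm.var i.castSucc)) (.var (Fin.last n)))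
    rw [Fm.subst_liftSubst_inst] at h1
    have h2 : (Fin.snoc (fun i : Fin n => Tm.var i.castSucc) (.var (Fin.last n)) :
        Fin (n + 1) → Tm (n + 1)) = Tm.var := by
      funext i
      refine Fin.lastCases ?_ (fun i => ?_) i <;> simp
    rw [h2, Fm.subst_var] at h1
    exact h1
  exact contrapose' h

/-! ### Closed terms in PAT -/

theorem eq_subst (F : Fm (n + 1)) {t u : Tm n} (h : Prov n (t ≐ u)) :
    Prov n (F.inst t ⟹ F.inst u) := .mp (.log (.eqSubst F t u)) h

theorem eq_inst (x : Tm n) (y : Tm (n + 1)) (t : Tm n) :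
    (x.lift ≐ y).inst t = (x ≐ y.subst (Fin.snoc Tm.var t)) := by
  simp [Fm.inst, Fm.subst, Tm.lift_subst]

theorem eq_symm {t u : Tm n} (h : Prov n (t ≐ u)) : Prov n (u ≐ t) := by
  have h1 := eq_subst (.var (Fin.last n) ≐ t.lift) h
  simp only [Fm.inst, Fm.subst, Tm.lift_subst, Tm.subst, Fin.snoc_last, Fin.snoc_castSucc,
    Tm.subst_var] at h1
  exact .mp h1 (.log (.eqRefl t))

theorem eq_trans {t u w : Tm n} (h : Prov n (t ≐ u)) (h' : Prov n (u ≐ w)) : Prov n (t ≐ w) := by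
  have h1 := eq_subst (t.lift ≐ .var (Fin.last n)) h'
  simp only [eq_inst, Tm.subst, Fin.snoc_last] at h1
  exact .mp h1 h

theorem eq_congr (x : Tm (n + 1)) {t u : Tm n} (h : Prov n (t ≐ u)) :
    Prov n (x.subst (Fin.snoc Tm.var t) ≐ x.subst (Fin.snoc Tm.var u)) := by
  have h1 := eq_subst ((x.subst (Fin.snoc Tm.var t)).lift ≐ x) h
  rw [eq_inst, eq_inst] at h1
  exact .mp h1 (.log (.eqRefl _))

theorem eq_succ {t u : Tm n} (h : Prov n (t ≐ u)) : Prov n (.succ t ≐ .succ u) := by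
  simpa [Tm.subst] using eq_congr (.succ (.var (Fin.last n))) h

theorem eq_add {t u t' u' : Tm n} (h : Prov n (t ≐ u)) (h' : Prov n (t' ≐ u')) :
    Prov n (.add t t' ≐ .add u u') := by
  have h1 := eq_congr (.add (.var (Fin.last n)) t'.lift) h
  have h2 := eq_congr (.add u.lift (.var (Fin.last n))) h'
  simp only [Tm.subst, Tm.lift_subst, Fin.snoc_last, Fin.snoc_castSucc, Tm.subst_var] at h1 h2
  exact eq_trans h1 h2

theorem eq_mul {t u t' u' : Tm n} (h : Prov n (t ≐ u)) (h' : Prov n (t' ≐ u')) :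
    Prov n (.mul t t' ≐ .mul u u') := by
  have h1 := eq_congr (.mul (.var (Fin.last n)) t'.lift) h
  have h2 := eq_congr (.mul u.lift (.var (Fin.last n))) h'
  simp only [Tm.subst, Tm.lift_subst, Fin.snoc_last, Fin.snoc_castSucc, Tm.subst_var] at h1 h2
  exact eq_trans h1 h2

theorem nm_add (k l : ℕ) : Prov n (.add (nm k) (nm l) ≐ nm (k + l)) := by
  induction l with
  | zero => exact .arith (.addZero _)
  | succ l ih => exact eq_trans (.arith (.addSucc _ _)) (eq_succ ih)

theorem nm_mul (k l : ℕ) : Prov n (.mul (nm k) (nm l) ≐ nm (k * l)) := by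
  induction l with
  | zero => exact .arith (.mulZero _)
  | succ l ih =>
    exact eq_trans (.arith (.mulSucc _ _))
      (eq_trans (eq_add ih (.log (.eqRefl _))) (nm_add (k * l) k))

theorem eq_nm_ev (t : CTm) : Prov 0 (t ≐ nm (ev t)) := by
  induction t with
  | var i => exact i.elim0
  | zero => exact .log (.eqRefl _)
  | succ t ih => exact eq_succ ih
  | add t u iht ihu => exact eq_trans (eq_add iht ihu) (nm_add _ _)
  | mul t u iht ihu => exact eq_trans (eq_mul iht ihu) (nm_mul _ _)

theorem eq_of_ev {t u : CTm} (h : ev t = ev u) : Prov 0 (t ≐ u) :=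
  eq_trans (eq_nm_ev t) (h ▸ eq_symm (eq_nm_ev u))

/-- Closed terms with the same value may be replaced by each other. -/
theorem inst_of_ev (F : Fm 1) {t u : CTm} (h : ev t = ev u) : Prov 0 (F.inst t ⟹ F.inst u) :=
  eq_subst F (eq_of_ev h)

end Prov

/-! ### The formulas for `ξ` and `ξ*` -/

section Inversion
variable {n : ℕ} {φ : Fm n} {a b : ℕ}

theorem code_eq_neg : φ.code = pr 8 a ↔ ∃ ψ, φ = .neg ψ ∧ a = ψ.code := by
  cases φ <;> simp [Fm.code, pr_inj, eq_comm]

theorem code_eq_or : φ.code = pr 9 (pr a b) ↔ ∃ ψ χ, φ = (ψ ⋎ χ) ∧ a = ψ.code ∧ b = χ.code := by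
  cases φ <;> simp [Fm.code, pr_inj, eq_comm]

theorem code_eq_and : φ.code = pr 10 (pr a b) ↔ ∃ ψ χ, φ = (ψ ⋏ χ) ∧ a = ψ.code ∧ b = χ.code := by
  cases φ <;> simp [Fm.code, pr_inj, eq_comm]

theorem code_eq_all : φ.code = pr 11 a ↔ ∃ ψ, φ = .all ψ ∧ a = ψ.code := by
  cases φ <;> simp [Fm.code, pr_inj, eq_comm]

theorem code_eq_ex : φ.code = pr 12 a ↔ ∃ ψ, φ = .ex ψ ∧ a = ψ.code := by
  cases φ <;> simp [Fm.code, pr_inj, eq_comm]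

end Inversion

theorem isVal_code (t : CTm) (y : ℕ) : IsVal t.code y ↔ y = ev t :=
  ⟨fun ⟨_, h, hy⟩ => by rw [hy, Tm.code_injective h], fun h => ⟨t, rfl, h⟩⟩

@[simp] theorem sat_evEq (S : Set ℕ) {n : ℕ} (x y : Tm n) (e : Fin n → ℕ) :
    (evEq x y).Sat S e ↔ ∃ a, IsVal (x.val e) a ∧ IsVal (y.val e) a := by
  simp [evEq]

@[simp] theorem sat_evNe (S : Set ℕ) {n : ℕ} (x y : Tm n) (e : Fin n → ℕ) :
    (evNe x y).Sat S e ↔ ∃ a b, IsVal (x.val e) a ∧ IsVal (y.val e) b ∧ ¬ a = b := by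
  simp [evNe]

@[simp] theorem sat_isSub (S : Set ℕ) {n : ℕ} (x t z : Tm n) (e : Fin n → ℕ) :
    (isSub x t z).Sat S e ↔ Repl (InstCl 0 (t.val e)) (x.val e) (z.val e) := by
  simp [isSub]

theorem sat_true0F (S : Set ℕ) (χ : Sentence) : true0F.Sat S ![χ.code] ↔ True0 χ := by
  simp only [true0F, dEq, dNeg, sat_ex, sat_or, sat_and, sat_eq, sat_isCT, sat_evEq, sat_evNe,
    snoc_vecCons, snoc_vecEmpty, val_var, val_dPr, Tm.val_nm, Matrix.cons_val]
  constructor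
  · rintro ⟨_, _, ⟨s, rfl⟩, ⟨t, rfl⟩, ⟨h, y, hs, ht⟩ | ⟨h, y, z, hs, ht, hne⟩⟩
    · rw [isVal_code] at hs ht
      exact .inl ⟨s, t, Fm.code_injective h, hs.symm.trans ht⟩
    · rw [isVal_code] at hs ht
      exact .inr ⟨s, t, Fm.code_injective h, by rwa [← hs, ← ht]⟩
  · rintro (⟨s, t, rfl, h⟩ | ⟨s, t, rfl, h⟩)
    · exact ⟨_, _, ⟨s, rfl⟩, ⟨t, rfl⟩, .inl ⟨rfl, _, ⟨s, rfl, rfl⟩, ⟨t, rfl, h⟩⟩⟩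
    · exact ⟨_, _, ⟨s, rfl⟩, ⟨t, rfl⟩, .inr ⟨rfl, _, _, ⟨s, rfl, rfl⟩, ⟨t, rfl, rfl⟩, h⟩⟩

/-- Quantification over the code of an instance of `φ`. -/
theorem exists_inst (φ : Fm 1) (t : CTm) (p : ℕ → Prop) :
    (∃ z, Repl (InstCl 0 t.code) φ.code z ∧ p z) ↔ p (φ.inst t).code := by
  simp only [repl_instCl, exists_eq_left]

theorem sat_xiF (S : Set ℕ) (χ : Sentence) : xiF.Sat S ![χ.code] ↔ Xi S χ := by
  simp only [xiF, sat_or, sat_true0F, Xi]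
  simp only [dNeg, dOr, dAnd, dAll, dEx, dTr, sat_ex, sat_all, sat_or, sat_and, sat_eq, sat_tr,
    sat_neg, Fm.sat_imp, sat_isCT, sat_isVal, sat_isSub, sat_isSent,
    snoc_vecCons, snoc_vecEmpty, val_var, val_dPr, Tm.val_nm, Matrix.cons_val]
  refine or_congr Iff.rfl (or_congr ?_ (or_congr ?_ (or_congr ?_ (or_congr ?_ (or_congr ?_
    (or_congr ?_ (or_congr ?_ (or_congr ?_ (or_congr ?_ (or_congr ?_ ?_))))))))))
  · constructor
    · rintro ⟨a, h, ha⟩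
      obtain ⟨ψ, rfl, h1⟩ := code_eq_neg.1 h
      obtain ⟨φ, rfl, rfl⟩ := code_eq_neg.1 h1.symm
      exact ⟨φ, rfl, ha⟩
    · rintro ⟨φ, rfl, h⟩
      exact ⟨_, rfl, h⟩
  · constructor
    · rintro ⟨a, b, h, h'⟩
      obtain ⟨φ, ψ, rfl, rfl, rfl⟩ := code_eq_or.1 h
      exact ⟨φ, ψ, rfl, h'⟩
    · rintro ⟨φ, ψ, rfl, h⟩
      exact ⟨_, _, rfl, h⟩
  · constructor
    · rintro ⟨a, b, h, h'⟩
      obtain ⟨χ, rfl, h1⟩ := code_eq_neg.1 h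
      obtain ⟨φ, ψ, rfl, rfl, rfl⟩ := code_eq_or.1 h1.symm
      exact ⟨φ, ψ, rfl, h'⟩
    · rintro ⟨φ, ψ, rfl, h⟩
      exact ⟨_, _, rfl, h⟩
  · constructor
    · rintro ⟨a, b, h, h'⟩
      obtain ⟨φ, ψ, rfl, rfl, rfl⟩ := code_eq_and.1 h
      exact ⟨φ, ψ, rfl, h'⟩
    · rintro ⟨φ, ψ, rfl, h⟩
      exact ⟨_, _, rfl, h⟩
  · constructor
    · rintro ⟨a, b, h, h'⟩
      obtain ⟨χ, rfl, h1⟩ := code_eq_neg.1 h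
      obtain ⟨φ, ψ, rfl, rfl, rfl⟩ := code_eq_and.1 h1.symm
      exact ⟨φ, ψ, rfl, h'⟩
    · rintro ⟨φ, ψ, rfl, h⟩
      exact ⟨_, _, rfl, h⟩
  · constructor
    · rintro ⟨a, h, h'⟩
      obtain ⟨φ, rfl, rfl⟩ := code_eq_all.1 h
      exact ⟨φ, rfl, fun t => (exists_inst φ t _).1 (h' _ ⟨t, rfl⟩)⟩
    · rintro ⟨φ, rfl, h⟩
      refine ⟨_, rfl, ?_⟩
      rintro _ ⟨t, rfl⟩
      exact (exists_inst φ t _).2 (h t)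
  · constructor
    · rintro ⟨a, h, _, ⟨t, rfl⟩, h'⟩
      obtain ⟨χ, rfl, h1⟩ := code_eq_neg.1 h
      obtain ⟨φ, rfl, rfl⟩ := code_eq_all.1 h1.symm
      exact ⟨φ, rfl, t, (exists_inst φ t fun z => pr 8 z ∈ S).1 h'⟩
    · rintro ⟨φ, rfl, t, h⟩
      exact ⟨_, rfl, _, ⟨t, rfl⟩, (exists_inst φ t fun z => pr 8 z ∈ S).2 h⟩
  · constructor
    · rintro ⟨a, h, _, ⟨t, rfl⟩, h'⟩
      obtain ⟨φ, rfl, rfl⟩ := code_eq_ex.1 h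
      exact ⟨φ, rfl, t, (exists_inst φ t _).1 h'⟩
    · rintro ⟨φ, rfl, t, h⟩
      exact ⟨_, rfl, _, ⟨t, rfl⟩, (exists_inst φ t _).2 h⟩
  · constructor
    · rintro ⟨a, h, h'⟩
      obtain ⟨χ, rfl, h1⟩ := code_eq_neg.1 h
      obtain ⟨φ, rfl, rfl⟩ := code_eq_ex.1 h1.symm
      exact ⟨φ, rfl, fun t => (exists_inst φ t fun z => pr 8 z ∈ S).1 (h' _ ⟨t, rfl⟩)⟩
    · rintro ⟨φ, rfl, h⟩
      refine ⟨_, rfl, ?_⟩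
      rintro _ ⟨t, rfl⟩
      exact (exists_inst φ t fun z => pr 8 z ∈ S).2 (h t)
  · constructor
    · rintro ⟨_, y, ⟨t, rfl⟩, hy, h, h'⟩
      rw [isVal_code] at hy
      subst hy
      exact ⟨t, Fm.code_injective h, h'⟩
    · rintro ⟨t, rfl, h⟩
      exact ⟨_, _, ⟨t, rfl⟩, ⟨t, rfl, rfl⟩, rfl, h⟩
  · constructor
    · rintro ⟨_, y, ⟨t, rfl⟩, hy, h, h'⟩
      rw [isVal_code] at hy
      subst hy
      exact ⟨t, Fm.code_injective h, h'⟩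
    · rintro ⟨t, rfl, h⟩
      exact ⟨_, _, ⟨t, rfl⟩, ⟨t, rfl, rfl⟩, rfl, h⟩

theorem sat_xiStarF (S : Set ℕ) (χ : Sentence) : xiStarF.Sat S ![χ.code] ↔ XiStar S χ := by
  simp only [xiStarF, sat_or, sat_xiF, XiStar]
  simp only [dNeg, dTr, sat_ex, sat_and, sat_eq, sat_tr, sat_isCT, sat_isVal, sat_isSent,
    snoc_vecCons, snoc_vecEmpty, val_var, val_dPr, Tm.val_nm, Matrix.cons_val]
  refine or_congr Iff.rfl (or_congr ?_ ?_)
  · constructor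
    · rintro ⟨_, y, ⟨t, rfl⟩, hy, rfl, -, h⟩
      exact ⟨t, ((isVal_code t _).1 hy).symm, h⟩
    · rintro ⟨t, ht, h⟩
      exact ⟨_, _, ⟨t, rfl⟩, ⟨t, rfl, ht.symm⟩, rfl, ⟨χ, rfl⟩, h⟩
  · constructor
    · rintro ⟨_, y, ⟨t, rfl⟩, hy, h, -, h'⟩
      obtain ⟨φ, rfl, rfl⟩ := code_eq_neg.1 h
      exact ⟨t, φ, rfl, ((isVal_code t _).1 hy).symm, h'⟩
    · rintro ⟨t, φ, rfl, ht, h⟩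
      exact ⟨_, _, ⟨t, rfl⟩, ⟨t, rfl, ht.symm⟩, rfl, ⟨.neg φ, rfl⟩, h⟩

@[simp] theorem sat_xiStar (S : Set ℕ) {n : ℕ} (x : Tm n) (e : Fin n → ℕ) :
    (xiStar x).Sat S e ↔ xiStarF.Sat S ![x.val e] := by
  simp only [xiStar, sat_subst_one]

/-! ### The axioms of IT* in the standard model -/

section Axioms
variable (S : Set ℕ)

theorem sat_IT1 : IT1.Sat S ![] ↔ ∀ s t : CTm, ((s ≐ t : Sentence).code ∈ S ↔ ev s = ev t) ∧
    ((Fm.neg (s ≐ t) : Sentence).code ∈ S ↔ ev s ≠ ev t) := by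
  simp only [IT1, dEq, dNeg, sat_all, sat_and, sat_tr, Fm.sat_imp, Fm.sat_iff, sat_isCT, sat_evEq,
    sat_evNe, snoc_vecCons, snoc_vecEmpty, val_var, val_dPr, Tm.val_nm, Matrix.cons_val]
  have h1 : ∀ s t : CTm, (∃ y, IsVal s.code y ∧ IsVal t.code y) ↔ ev s = ev t := fun s t => by
    simp only [isVal_code, exists_eq_left]
  have h2 : ∀ s t : CTm, (∃ y z, IsVal s.code y ∧ IsVal t.code z ∧ ¬ y = z) ↔ ev s ≠ ev t :=
    fun s t => by simp [isVal_code]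
  constructor
  · rintro ⟨h, h'⟩ s t
    exact ⟨(h _ _ ⟨⟨s, rfl⟩, ⟨t, rfl⟩⟩).trans (h1 s t), (h' _ _ ⟨⟨s, rfl⟩, ⟨t, rfl⟩⟩).trans (h2 s t)⟩
  · intro h
    constructor
    · rintro _ _ ⟨⟨s, rfl⟩, ⟨t, rfl⟩⟩
      exact (h s t).1.trans (h1 s t).symm
    · rintro _ _ ⟨⟨s, rfl⟩, ⟨t, rfl⟩⟩
      exact (h s t).2.trans (h2 s t).symm

theorem sat_IT2 : IT2.Sat S ![] ↔
    ∀ φ ψ : Sentence, φ.code ∈ S → ψ.code ∈ S → (φ ⋏ ψ).code ∈ S := by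
  simp only [IT2, dAnd, sat_all, sat_and, sat_tr, Fm.sat_imp, sat_isSent,
    snoc_vecCons, snoc_vecEmpty, val_var, val_dPr, Tm.val_nm, Matrix.cons_val]
  constructor
  · exact fun h φ ψ hφ hψ => h _ _ ⟨φ ⋏ ψ, rfl⟩ ⟨hφ, hψ⟩
  · rintro h a b ⟨χ, hχ⟩ ⟨ha, hb⟩
    obtain ⟨φ, ψ, rfl, rfl, rfl⟩ := code_eq_and.1 hχ.symm
    exact h φ ψ ha hb

theorem isProv_imp (a : ℕ) (φ : Sentence) :
    (∃ χ : Sentence, pr 9 (pr (pr 8 a) φ.code) = χ.code ∧ Prov 0 χ) ↔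
      ∃ ψ : Sentence, a = ψ.code ∧ Prov 0 (ψ ⟹ φ) := by
  constructor
  · rintro ⟨χ, h, hχ⟩
    obtain ⟨ψ, φ', rfl, h1, rfl⟩ := code_imp_inv h.symm
    obtain rfl := Fm.code_injective h1
    exact ⟨ψ, rfl, hχ⟩
  · rintro ⟨ψ, rfl, h⟩
    exact ⟨_, rfl, h⟩

theorem exists_xiStar_prov (φ : Sentence) :
    (∃ z, xiStarF.Sat S ![z] ∧
      ∃ χ : Sentence, pr 9 (pr (pr 8 z) φ.code) = χ.code ∧ Prov 0 χ) ↔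
      ∃ ψ, XiStar S ψ ∧ Prov 0 (ψ ⟹ φ) := by
  simp only [isProv_imp]
  constructor
  · rintro ⟨_, h, ψ, rfl, h'⟩
    exact ⟨ψ, (sat_xiStarF S ψ).1 h, h'⟩
  · rintro ⟨ψ, h, h'⟩
    exact ⟨_, (sat_xiStarF S ψ).2 h, ψ, rfl, h'⟩

theorem sat_IT3 : IT3.Sat S ![] ↔ ∀ φ ψ : Sentence,
    (φ.code ∈ S ∨ ψ.code ∈ S ∨ ∃ χ, XiStar S χ ∧ Prov 0 (χ ⟹ φ ⋎ ψ)) ↔ (φ ⋎ ψ).code ∈ S := by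
  simp only [IT3, dOr, dImp, dNeg, sat_all, sat_ex, sat_or, sat_and, sat_tr, Fm.sat_imp, Fm.sat_iff,
    sat_isSent, sat_xiStar, sat_isProv, snoc_vecCons, snoc_vecEmpty, val_var, val_dPr, Tm.val_nm,
    Matrix.cons_val]
  constructor
  · intro h φ ψ
    rw [← exists_xiStar_prov]
    exact h _ _ ⟨φ ⋎ ψ, rfl⟩
  · rintro h a b ⟨χ, hχ⟩
    obtain ⟨φ, ψ, rfl, rfl, rfl⟩ := code_eq_or.1 hχ.symm
    have := h φ ψ
    rw [← exists_xiStar_prov] at this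
    exact this

theorem sat_IT4 : IT4.Sat S ![] ↔
    ∀ φ : Fm 1, (∀ t : CTm, (φ.inst t).code ∈ S) → (Fm.all φ : Sentence).code ∈ S := by
  simp only [IT4, dAll, sat_all, sat_ex, sat_and, sat_tr, Fm.sat_imp, sat_isSent, sat_isCT, sat_isSub,
    snoc_vecCons, snoc_vecEmpty, val_var, val_dPr, Tm.val_nm, Matrix.cons_val]
  constructor
  · intro h φ hφ
    refine h _ ⟨.all φ, rfl⟩ ?_
    rintro _ ⟨t, rfl⟩
    exact (exists_inst φ t _).2 (hφ t)
  · rintro h a ⟨χ, hχ⟩ h'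
    obtain ⟨φ, rfl, rfl⟩ := code_eq_all.1 hχ.symm
    exact h φ fun t => (exists_inst φ t _).1 (h' _ ⟨t, rfl⟩)

theorem sat_IT5 : IT5.Sat S ![] ↔ ∀ φ : Fm 1,
    ((∃ t : CTm, (φ.inst t).code ∈ S) ∨ ∃ χ, XiStar S χ ∧ Prov 0 (χ ⟹ .ex φ)) ↔
      (Fm.ex φ : Sentence).code ∈ S := by
  simp only [IT5, dEx, dOr, dImp, dNeg, sat_all, sat_ex, sat_or, sat_and, sat_tr, Fm.sat_imp,
    Fm.sat_iff, sat_isSent, sat_isCT, sat_isSub, sat_xiStar, sat_isProv,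
    snoc_vecCons, snoc_vecEmpty, val_var, val_dPr, Tm.val_nm, Matrix.cons_val]
  have h1 : ∀ φ : Fm 1, (∃ x, IsTm 0 x ∧ ∃ z, Repl (InstCl 0 x) φ.code z ∧ z ∈ S) ↔
      ∃ t : CTm, (φ.inst t).code ∈ S := fun φ => by
    constructor
    · rintro ⟨_, ⟨t, rfl⟩, h⟩
      exact ⟨t, (exists_inst φ t _).1 h⟩
    · rintro ⟨t, h⟩
      exact ⟨_, ⟨t, rfl⟩, (exists_inst φ t _).2 h⟩
  constructor
  · intro h φ
    rw [← exists_xiStar_prov, ← h1]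
    exact h _ ⟨.ex φ, rfl⟩
  · rintro h a ⟨χ, hχ⟩
    obtain ⟨φ, rfl, rfl⟩ := code_eq_ex.1 hχ.symm
    have := h φ
    rw [← exists_xiStar_prov, ← h1] at this
    exact this

theorem sat_IT6 : IT6.Sat S ![] ↔ ∀ x, x ∈ S ↔ (Fm.tr (nm x) : Sentence).code ∈ S := by
  simp only [IT6, dTr, sat_all, sat_tr, Fm.sat_imp, Fm.sat_iff, sat_isNum,
    snoc_vecCons, snoc_vecEmpty, val_var, val_dPr, Tm.val_nm, Matrix.cons_val, forall_eq]
  exact Iff.rfl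

theorem sat_IT7 : IT7.Sat S ![] ↔ ∀ x, (negCode x ∈ S ∨ ¬ IsSent x) ↔
    (Fm.neg (.tr (nm x)) : Sentence).code ∈ S := by
  simp only [IT7, dTr, dNeg, sat_all, sat_tr, sat_or, sat_neg, Fm.sat_imp, Fm.sat_iff, sat_isNum,
    sat_isSent, snoc_vecCons, snoc_vecEmpty, val_var, val_dPr, Tm.val_nm, Matrix.cons_val, forall_eq]
  exact Iff.rfl

theorem sat_IT8 : IT8.Sat S ![] ↔
    ∀ φ ψ : Sentence, φ.code ∈ S → Prov 0 (φ ⟹ ψ) → ψ.code ∈ S := by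
  simp only [IT8, dOr, dImp, dNeg, sat_all, sat_and, sat_tr, Fm.sat_imp, sat_isProv,
    snoc_vecCons, snoc_vecEmpty, val_var, val_dPr, Tm.val_nm, Matrix.cons_val]
  constructor
  · exact fun h φ ψ hφ hψ => h _ _ ⟨hφ, _, rfl, hψ⟩
  · rintro h a b ⟨ha, χ, e, hχ⟩
    obtain ⟨φ, ψ, rfl, rfl, rfl⟩ := code_imp_inv e.symm
    exact h φ ψ ha hχ

theorem sat_IT9 : IT9.Sat S ![] ↔ ∀ x, negCode x ∈ S → x ∉ S := by
  simp only [IT9, dNeg, sat_all, sat_neg, sat_tr, Fm.sat_imp,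
    snoc_vecEmpty, val_var, val_dPr, Tm.val_nm, Matrix.cons_val]
  exact Iff.rfl

/-- The sentence `∀x (Tr x → Sent(x))`. -/
def trSent : Sentence := .all (.tr (v 0) ⟹ isSent (v 0))

theorem sat_IT10 : IT10.Sat S ![] ↔ trSent.code ∈ S := by
  simp only [IT10, sat_tr, quo, Tm.val_nm]
  exact Iff.rfl

theorem sat_trDot (φ : Fm 1) {n : ℕ} (x : Tm n) (e : Fin n → ℕ) :
    (trDot φ x).Sat S e ↔ (φ.inst (nm (x.val e))).code ∈ S := by
  simp only [trDot, quo, sat_subst_one, sat_ex, sat_and, sat_tr, sat_isNum, sat_isSub,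
    snoc_vecCons, snoc_vecEmpty, val_var, Tm.val_nm, Matrix.cons_val]
  simp only [exists_and_left, exists_eq_left, repl_instCl]

end Axioms

/-! ### True arithmetic -/

/-- The truth predicate does not occur in the formula. -/
def TrFree : {n : ℕ} → Fm n → Prop
  | _, .eq _ _ => True
  | _, .tr _ => False
  | _, .neg φ => TrFree φ
  | _, .or φ ψ => TrFree φ ∧ TrFree ψ
  | _, .and φ ψ => TrFree φ ∧ TrFree ψ
  | _, .all φ => TrFree φ
  | _, .ex φ => TrFree φ

theorem TrFree.subst {n m : ℕ} {φ : Fm n} (h : TrFree φ) (σ : Fin n → Tm m) :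
    TrFree (φ.subst σ) := by
  induction φ generalizing m <;> simp_all [TrFree, Fm.subst]

theorem trFree_isTm {n : ℕ} (k x : Tm n) : TrFree (isTm k x) := by
  refine TrFree.subst ?_ _
  simp [tmF, TrFree, Fm.imp, mem, lt, memF, ltF, Fm.subst]

theorem trFree_isSent {n : ℕ} (x : Tm n) : TrFree (isSent x) := by
  refine TrFree.subst ?_ _
  simp [fmF, TrFree, Fm.imp, trFree_isTm, mem, memF, Fm.subst]

theorem ev_snoc {n : ℕ} (σ : Fin n → CTm) (t : CTm) :
    (fun i => ev ((Fin.snoc σ t : Fin (n + 1) → CTm) i)) =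
      (Fin.snoc (fun i => ev (σ i)) (ev t) : Fin (n + 1) → ℕ) := by
  funext i
  refine Fin.lastCases ?_ (fun i => ?_) i <;> simp

/-- A set closed under the clauses of `ξ` contains every true sentence in which the truth predicate does
not occur. -/
theorem TrFree.code_mem {S : Set ℕ} (hS : ∀ χ, Xi S χ → χ.code ∈ S) {n : ℕ} {φ : Fm n}
    (h : TrFree φ) (σ : Fin n → CTm) :
    (φ.Sat S (fun i => ev (σ i)) → (φ.subst σ).code ∈ S) ∧
      (¬ φ.Sat S (fun i => ev (σ i)) → (Fm.neg (φ.subst σ)).code ∈ S) := by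
  induction φ with
  | eq t u =>
    have ht : ∀ t : Tm _, ev (t.subst σ) = t.val fun i => ev (σ i) := fun t => Tm.val_subst σ _ t
    constructor
    · intro h
      exact hS _ (.inl (.inl ⟨_, _, rfl, by rw [ht, ht]; exact h⟩))
    · intro h
      exact hS _ (.inl (.inr ⟨_, _, rfl, by rw [ht, ht]; exact h⟩))
  | tr t => exact h.elim
  | neg φ ih =>
    have ih := ih h σ
    refine ⟨ih.2, fun h => hS _ (.inr (.inl ⟨_, rfl, ih.1 ?_⟩))⟩
    simpa using h
  | or φ ψ ih ih' =>
    have ih := ih h.1 σ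
    have ih' := ih' h.2 σ
    constructor
    · intro h
      exact hS _ (.inr (.inr (.inl ⟨_, _, rfl, h.imp ih.1 ih'.1⟩)))
    · intro h
      rw [sat_or, not_or] at h
      exact hS _ (.inr (.inr (.inr (.inl ⟨_, _, rfl, ih.2 h.1, ih'.2 h.2⟩))))
  | and φ ψ ih ih' =>
    have ih := ih h.1 σ
    have ih' := ih' h.2 σ
    constructor
    · intro h
      exact hS _ (.inr (.inr (.inr (.inr (.inl ⟨_, _, rfl, ih.1 h.1, ih'.1 h.2⟩)))))
    · intro h
      rw [sat_and, not_and_or] at h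
      exact hS _ (.inr (.inr (.inr (.inr (.inr (.inl ⟨_, _, rfl, h.imp ih.2 ih'.2⟩))))))
  | all φ ih =>
    have ih := fun t => ih h (Fin.snoc σ t)
    simp only [ev_snoc, ← Fm.subst_liftSubst_inst] at ih
    constructor
    · intro h
      exact hS _ (.inr (.inr (.inr (.inr (.inr (.inr (.inl ⟨_, rfl, fun t => (ih t).1 (h _)⟩)))))))
    · intro h
      rw [sat_all, not_forall] at h
      obtain ⟨a, ha⟩ := h
      exact hS _ (.inr (.inr (.inr (.inr (.inr (.inr (.inr (.inl
        ⟨_, rfl, nm a, (ih _).2 (by rwa [ev_nm])⟩))))))))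
  | ex φ ih =>
    have ih := fun t => ih h (Fin.snoc σ t)
    simp only [ev_snoc, ← Fm.subst_liftSubst_inst] at ih
    constructor
    · rintro ⟨a, ha⟩
      exact hS _ (.inr (.inr (.inr (.inr (.inr (.inr (.inr (.inr (.inl
        ⟨_, rfl, nm a, (ih _).1 (by rwa [ev_nm])⟩)))))))))
    · intro h
      rw [sat_ex, not_exists] at h
      exact hS _ (.inr (.inr (.inr (.inr (.inr (.inr (.inr (.inr (.inr (.inl
        ⟨_, rfl, fun t => (ih t).2 (h _)⟩))))))))))

/-! ### Fixed points and models -/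

/-- The supervaluation operator with the additional admissible premises `E`. -/
def Theta (E : Sentence → Prop) (S : Set ℕ) : Set ℕ :=
  {x | ∃ φ ψ : Sentence, x = φ.code ∧ (XiStar S ψ ∨ E ψ) ∧ Prov 0 (ψ ⟹ φ)}

theorem inst_eq_vec (F : Fm 1) (t : CTm) : F.inst t = F.subst ![t] := by
  rw [Fm.inst, snoc_vecEmpty]

theorem Prov.tr_of_ev {t u : CTm} (h : ev t = ev u) : Prov 0 (.tr t ⟹ .tr u) := by
  have := Prov.inst_of_ev (.tr (v 0)) h
  simp only [inst_eq_vec] at this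
  exact this

theorem Prov.neg_tr_of_ev {t u : CTm} (h : ev t = ev u) : Prov 0 (.neg (.tr t) ⟹ .neg (.tr u)) :=
  .contrapose (.tr_of_ev h.symm)

section FixedPoint
variable {S : Set ℕ}

theorem Xi.tr {t : CTm} (h : ev t ∈ S) : Xi S (.tr t) :=
  .inr <| .inr <| .inr <| .inr <| .inr <| .inr <| .inr <| .inr <| .inr <| .inr <| .inl ⟨t, rfl, h⟩

theorem Xi.neg_tr {t : CTm} (h : negCode (ev t) ∈ S ∨ ¬ IsSent (ev t)) : Xi S (.neg (.tr t)) :=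
  .inr <| .inr <| .inr <| .inr <| .inr <| .inr <| .inr <| .inr <| .inr <| .inr <| .inr ⟨t, rfl, h⟩

theorem isSent_of_negCode {x : ℕ} (h : IsSent (negCode x)) : IsSent x := by
  obtain ⟨χ, hχ⟩ := h
  obtain ⟨φ, -, rfl⟩ := code_eq_neg.1 hχ.symm
  exact ⟨φ, rfl⟩

theorem models_of_fixedPoint {E : Sentence → Prop} (hS : S = Theta E S) (hC : CON S) :
    Models S ITstar ∧ ∀ ψ, E ψ → ψ.code ∈ S := by
  have hsent : ∀ x ∈ S, IsSent x := by
    intro x hx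
    rw [hS] at hx
    obtain ⟨φ, -, rfl, -⟩ := hx
    exact ⟨φ, rfl⟩
  have hmem : ∀ ψ, XiStar S ψ ∨ E ψ → ψ.code ∈ S := by
    intro ψ h
    rw [hS]
    exact ⟨ψ, ψ, rfl, h, .id ψ⟩
  have hXi : ∀ ψ, Xi S ψ → ψ.code ∈ S := fun ψ h => hmem ψ (.inl (.inl h))
  have hcl : ∀ φ ψ : Sentence, φ.code ∈ S → Prov 0 (φ ⟹ ψ) → ψ.code ∈ S := by
    intro φ ψ h hp
    rw [hS] at h ⊢
    obtain ⟨φ', χ, e, h, hp'⟩ := h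
    obtain rfl := Fm.code_injective e
    exact ⟨ψ, χ, rfl, h, hp'.trans hp⟩
  have hcon : ∀ φ : Sentence, (Fm.neg φ).code ∈ S → φ.code ∉ S := fun φ h h' => hC ⟨φ, h', h⟩
  -- By the downward clause for `Tr`, every element of `S` satisfies `ξ*`, including the consequences
  -- of the premises in `E`.
  have hstar : ∀ φ : Sentence, φ.code ∈ S → XiStar S φ := fun φ h =>
    .inr (.inl ⟨nm φ.code, ev_nm _, hXi _ (.tr (by rwa [ev_nm]))⟩)
  refine ⟨?_, fun ψ h => hmem ψ (.inr h)⟩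
  rintro φ (h | h)
  · exact Prov.sound S h _
  rcases h with rfl | rfl | rfl | rfl | rfl | rfl | rfl | rfl | rfl | rfl
  · rw [sat_IT1]
    intro s t
    have h1 : ev s = ev t → (s ≐ t : Sentence).code ∈ S := fun h =>
      hXi _ (.inl (.inl ⟨s, t, rfl, h⟩))
    have h2 : ev s ≠ ev t → (Fm.neg (s ≐ t) : Sentence).code ∈ S := fun h =>
      hXi _ (.inl (.inr ⟨s, t, rfl, h⟩))
    exact ⟨⟨fun h => by_contra fun h' => hcon _ (h2 h') h, h1⟩,
      ⟨fun h h' => hcon _ h (h1 h'), h2⟩⟩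
  · rw [sat_IT2]
    exact fun φ ψ h h' => hXi _ (.inr <| .inr <| .inr <| .inr <| .inl ⟨φ, ψ, rfl, h, h'⟩)
  · rw [sat_IT3]
    refine fun φ ψ => ⟨?_, fun h => .inr (.inr ⟨_, hstar _ h, .id _⟩)⟩
    rintro (h | h | ⟨χ, h, hp⟩)
    · exact hcl _ _ h (.log (.orLeft _ _))
    · exact hcl _ _ h (.log (.orRight _ _))
    · exact hcl _ _ (hmem χ (.inl h)) hp
  · rw [sat_IT4]
    exact fun φ h =>
      hXi _ (.inr <| .inr <| .inr <| .inr <| .inr <| .inr <| .inl ⟨φ, rfl, h⟩)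
  · rw [sat_IT5]
    refine fun φ => ⟨?_, fun h => .inr ⟨_, hstar _ h, .id _⟩⟩
    rintro (⟨t, h⟩ | ⟨χ, h, hp⟩)
    · exact hcl _ _ h (.log (.exIntro _ _))
    · exact hcl _ _ (hmem χ (.inl h)) hp
  · rw [sat_IT6]
    refine fun x => ⟨fun h => hXi _ (.tr (by rwa [ev_nm])), fun h => ?_⟩
    by_cases hx : IsSent x
    · obtain ⟨φ, rfl⟩ := hx
      exact hmem φ (.inl (.inr (.inl ⟨_, ev_nm _, h⟩)))
    · exact absurd h (hcon _ (hXi _ (.neg_tr (.inr (by rwa [ev_nm])))))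
  · rw [sat_IT7]
    refine fun x => ⟨fun h => hXi _ (.neg_tr (by rwa [ev_nm])), fun h => ?_⟩
    by_cases hx : IsSent x
    · obtain ⟨φ, rfl⟩ := hx
      exact .inl (hmem (.neg φ) (.inl (.inr (.inr ⟨_, φ, rfl, ev_nm _, h⟩))))
    · exact .inr hx
  · rw [sat_IT8]
    exact hcl
  · rw [sat_IT9]
    intro x h
    obtain ⟨φ, rfl⟩ := isSent_of_negCode (hsent _ h)
    exact hcon φ h
  · rw [sat_IT10]
    refine hXi _ (.inr <| .inr <| .inr <| .inr <| .inr <| .inr <| .inl ⟨_, rfl, fun t => ?_⟩)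
    rw [inst_eq_vec]
    change (Fm.imp (.tr t) ((isSent (v 0) : Fm 1).subst ![t])).code ∈ S
    by_cases ht : IsSent (ev t)
    · refine hcl _ _ (((trFree_isSent (v 0)).code_mem hXi ![t]).1 ?_) (.log (.orRight _ _))
      simpa using ht
    · exact hcl _ _ (hXi _ (.neg_tr (.inr ht))) (.log (.orLeft _ _))

/-- A model of IT* is closed under the clauses of `ξ*` and under provability, and contains only codes
of sentences: for a number `x` that is no such code, `Tr x` and `¬Tr x` would both be true. -/
theorem fixedPoint_of_models {E : Sentence → Prop} (hM : Models S ITstar)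
    (hE : ∀ ψ, E ψ → ψ.code ∈ S) : S = Theta E S ∧ CON S := by
  have ax : ∀ φ ∈ ({IT1, IT2, IT3, IT4, IT5, IT6, IT7, IT8, IT9, IT10} : Set Sentence),
      φ.Sat S ![] := fun φ h => hM φ (.inr h)
  have h1 := (sat_IT1 S).1 (ax _ (by simp))
  have h2 := (sat_IT2 S).1 (ax _ (by simp))
  have h4 := (sat_IT4 S).1 (ax _ (by simp))
  have h6 := (sat_IT6 S).1 (ax _ (by simp))
  have h7 := (sat_IT7 S).1 (ax _ (by simp))
  have h8 := (sat_IT8 S).1 (ax _ (by simp))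
  have h9 := (sat_IT9 S).1 (ax _ (by simp))
  have hsent : ∀ x ∈ S, IsSent x := fun x hx => by_contra fun h =>
    h9 _ ((h7 x).1 (.inr h)) ((h6 x).1 hx)
  have htr : ∀ t : CTm, (Fm.tr t : Sentence).code ∈ S ↔ ev t ∈ S := fun t => by
    rw [h6 (ev t)]
    exact ⟨fun h => h8 _ _ h (.tr_of_ev (ev_nm _).symm), fun h => h8 _ _ h (.tr_of_ev (ev_nm _))⟩
  have hntr : ∀ t : CTm, (Fm.neg (.tr t) : Sentence).code ∈ S ↔
      (negCode (ev t) ∈ S ∨ ¬ IsSent (ev t)) := fun t => by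
    rw [h7 (ev t)]
    exact ⟨fun h => h8 _ _ h (.neg_tr_of_ev (ev_nm _).symm),
      fun h => h8 _ _ h (.neg_tr_of_ev (ev_nm _))⟩
  have hXi : ∀ χ, Xi S χ → χ.code ∈ S := by
    rintro χ ((⟨s, t, rfl, h⟩ | ⟨s, t, rfl, h⟩) | ⟨φ, rfl, h⟩ | ⟨φ, ψ, rfl, h⟩ | ⟨φ, ψ, rfl, h, h'⟩ |
      ⟨φ, ψ, rfl, h, h'⟩ | ⟨φ, ψ, rfl, h⟩ | ⟨φ, rfl, h⟩ | ⟨φ, rfl, t, h⟩ | ⟨φ, rfl, t, h⟩ |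
      ⟨φ, rfl, h⟩ | ⟨t, rfl, h⟩ | ⟨t, rfl, h⟩)
    · exact (h1 s t).1.2 h
    · exact (h1 s t).2.2 h
    · exact h8 _ _ h (.dni φ)
    · exact h.elim (fun h => h8 _ _ h (.log (.orLeft _ _))) fun h => h8 _ _ h (.log (.orRight _ _))
    · exact h8 _ _ (h2 _ _ h h') (.neg_or_of_and_neg φ ψ)
    · exact h2 _ _ h h'
    · exact h.elim (fun h => h8 _ _ h (.contrapose (.log (.andLeft _ _))))
        fun h => h8 _ _ h (.contrapose (.log (.andRight _ _)))
    · exact h4 φ h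
    · exact h8 _ _ h (.contrapose (.log (.allElim _ _)))
    · exact h8 _ _ h (.log (.exIntro _ _))
    · exact h8 _ _ (h4 (.neg φ) h) (.neg_ex_of_all_neg φ)
    · exact (htr t).2 h
    · exact (hntr t).2 h
  have hXiStar : ∀ χ, XiStar S χ → χ.code ∈ S := by
    rintro χ (h | ⟨t, ht, h⟩ | ⟨t, φ, rfl, ht, h⟩)
    · exact hXi χ h
    · exact ht ▸ (htr t).1 h
    · rcases (hntr t).1 h with h | h
      · rw [ht] at h
        exact h
      · exact absurd ⟨φ, ht⟩ h
  refine ⟨Set.Subset.antisymm (fun x hx => ?_) ?_, fun ⟨φ, h, h'⟩ => h9 _ h' h⟩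
  · obtain ⟨φ, rfl⟩ := hsent x hx
    exact ⟨φ, φ, rfl, .inl (.inr (.inl ⟨nm φ.code, ev_nm _, (h6 _).1 hx⟩)), .id φ⟩
  · rintro _ ⟨φ, ψ, rfl, h, hp⟩
    exact h8 _ _ (h.elim (hXiStar ψ) (hE ψ)) hp

/-- The fixed points of the operator with additional premises `E` are the models of IT* that contain
`E`. -/
theorem fixedPoint_iff_models (E : Sentence → Prop) (S : Set ℕ) :
    (S = Theta E S ∧ CON S) ↔ Models S ITstar ∧ ∀ ψ, E ψ → ψ.code ∈ S :=
  ⟨fun h => models_of_fixedPoint h.1 h.2, fun h => fixedPoint_of_models h.1 h.2⟩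

theorem Models.closed (hM : Models S ITstar) :
    ∀ φ ψ : Sentence, φ.code ∈ S → Prov 0 (φ ⟹ ψ) → ψ.code ∈ S :=
  (sat_IT8 S).1 (hM _ (.inr (by simp)))

theorem models_union_singleton (S : Set ℕ) (T : Set Sentence) (φ : Sentence) :
    Models S (T ∪ {φ}) ↔ Models S T ∧ φ.Sat S ![] := by
  constructor
  · exact fun h => ⟨fun ψ hψ => h ψ (.inl hψ), h φ (.inr rfl)⟩
  · rintro ⟨h, h'⟩ ψ (hψ | rfl)
    · exact h ψ hψ
    · exact h'

/-- Closed terms with the same value may be replaced in two places independently. -/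
theorem Prov.subst_pair_of_ev (F : Fm 2) {s s' t t' : CTm} (hs : ev s = ev s') (ht : ev t = ev t') :
    Prov 0 (F.subst ![s, t] ⟹ F.subst ![s', t']) := by
  have h1 := Prov.inst_of_ev (F.subst ![v 0, t.lift]) hs
  have h2 := Prov.inst_of_ev (F.subst ![s'.lift, v 0]) ht
  have e1 : ∀ x y : CTm, (F.subst ![v 0, y.lift]).inst x = F.subst ![x, y] := fun x y => by
    rw [inst_eq_vec, Fm.subst_subst]
    congr 1
    funext i
    fin_cases i
    · rfl
    · exact (Tm.lift_subst y _).trans ((congrArg (y.subst ·) (Subsingleton.elim _ _)).trans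
        y.subst_var)
  have e2 : ∀ x y : CTm, (F.subst ![x.lift, v 0]).inst y = F.subst ![x, y] := fun x y => by
    rw [inst_eq_vec, Fm.subst_subst]
    congr 1
    funext i
    fin_cases i
    · exact (Tm.lift_subst x _).trans ((congrArg (x.subst ·) (Subsingleton.elim _ _)).trans
        x.subst_var)
    · rfl
  rw [e1, e1] at h1
  rw [e2, e2] at h2
  exact h1.trans h2

/-- In a closed theory it suffices to postulate an instance with two closed terms of equal value for
numerals. -/
theorem forall_pair_iff (hcl : ∀ φ ψ : Sentence, φ.code ∈ S → Prov 0 (φ ⟹ ψ) → ψ.code ∈ S)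
    (F : Fm 2) (p : ℕ → Prop) :
    (∀ a, p a → (F.subst ![nm a, nm a] : Sentence).code ∈ S) ↔
      ∀ s t : CTm, ev s = ev t → p (ev t) → (F.subst ![s, t]).code ∈ S := by
  constructor
  · intro h s t hst hp
    exact hcl _ _ (h _ hp) (.subst_pair_of_ev F ((ev_nm _).trans hst.symm) (ev_nm _))
  · intro h a ha
    exact h _ _ rfl (by rwa [ev_nm])

theorem sat_consAx (hM : Models S ITstar) :
    consAx.Sat S ![] ↔ ∀ ψ, Con ψ → ψ.code ∈ S := by
  simp only [consAx, sat_all, sat_trDot, snoc_vecEmpty, val_var, Matrix.cons_val, inst_eq_vec]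
  have h := forall_pair_iff hM.closed (.neg (.tr (v 0) ⋏ .tr (dNeg (v 1)))) fun _ => True
  simp only [true_imp_iff] at h
  refine h.trans ⟨?_, fun h s t hst => h _ ⟨s, t, rfl, hst⟩⟩
  rintro h _ ⟨s, t, rfl, hst⟩
  exact h s t hst

theorem sat_comAx (hM : Models S ITstar) :
    comAx.Sat S ![] ↔ ∀ ψ, Com ψ → ψ.code ∈ S := by
  simp only [comAx, sat_all, Fm.sat_imp, sat_isSent, sat_trDot, snoc_vecEmpty, val_var,
    Matrix.cons_val, inst_eq_vec]
  have h := forall_pair_iff hM.closed (.neg (.tr (v 0)) ⟺ .tr (dNeg (v 1))) IsSent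
  refine h.trans ⟨?_, fun h s t hst ht => h _ ⟨s, t, rfl, hst, ht⟩⟩
  rintro h _ ⟨s, t, rfl, hst, ht⟩
  exact h s t hst ht

end FixedPoint
end SupTruth

theorem mainTheorem3 :
    SupTruth.NCategorical SupTruth.ITstar
      (fun S => S = SupTruth.ThetaStar S ∧ SupTruth.CON S) ∧
    SupTruth.NCategorical SupTruth.ITstarC
      (fun S => S = SupTruth.ThetaStarC S ∧ SupTruth.CON S) ∧
    SupTruth.NCategorical SupTruth.ITstarMC
      (fun S => S = SupTruth.ThetaStarMC S ∧ SupTruth.CON S) := by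
  refine ⟨fun S => ?_, fun S => ?_, fun S => ?_⟩
  · have h : SupTruth.ThetaStar S = SupTruth.Theta (fun _ => False) S := by
      simp only [SupTruth.ThetaStar, SupTruth.Theta, or_false]
      rfl
    simpa [h] using SupTruth.fixedPoint_iff_models (fun _ => False) S
  · rw [SupTruth.ITstarC, SupTruth.models_union_singleton]
    exact (SupTruth.fixedPoint_iff_models SupTruth.Con S).trans
      (and_congr_right fun hM => (SupTruth.sat_consAx hM).symm)
  · rw [SupTruth.ITstarMC, SupTruth.models_union_singleton]
    exact (SupTruth.fixedPoint_iff_models SupTruth.Com S).trans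
      (and_congr_right fun hM => (SupTruth.sat_comAx hM).symm)
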